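/- **Setting.** A quota vector $\mathbf b=(b_1,\dots,b_n)$ consists of $n\ge 1$ positive integers (one per agent); there are $m=\sum_i b_i$ items, $b_{\max}=\max_i b_i$. A matching gives each item to at most one agent and at most $b_i$ items to agent $i$. A valuation profile $V=(v_{ig})$ has non-negative entries; the social welfare $\mathrm{SW}(M,V)$ of a matching $M$ is the total value of the agents for the items they get, and $\mathrm{OPT}(V,\mathbf b)$ is its maximum over all matchings. The valuation vectors of the agents are drawn independently, agent $i$'s from a distribution $F_i$ on $[0,\infty)^m$. A valuation vector induces a ranking of the items by decreasing value, ties being broken uniformly at random (independently across agents); the favorite items of agent $i$ are her $b_i$ top-ranked items. $F_i$ is *unbiased-favorites* (UF) if every set of $b_i$ items is equally likely to be the set of favorite items of agent $i$. An ordinal mechanism $\mathcal M$ maps $\mathbf b$ and the profile of rankings $P(V)$ to a (possibly random) matching. Define $$\mathrm{dist}(\mathcal M,\mathbf b)=\sup_{\mathcal F=(F_1,\dots,F_n)\ \mathrm{UF}}\frac{\mathbb E[\mathrm{OPT}(V,\mathbf b)]}{\mathbb E[\mathrm{SW}(\mathcal M(P(V),\mathbf b),V)]},\qquad \mathrm{dist}(\mathcal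 M)=\sup_{\mathbf b}\mathrm{dist}(\mathcal M,\mathbf b),$$ $$\mathrm{distgap}(\mathcal M)=\sup_{\mathbf b}\frac{\mathrm{dist}(\mathcal M,\mathbf b)}{\mathrm{dist}^*(\mathbf b)},\qquad \mathrm{dist}^*(\mathbf b)=\inf_{\mathcal M'}\mathrm{dist}(\mathcal M',\mathbf b),$$ where the ratios $0/0$ and $\infty/\infty$ are disregarded in the first supremum and the infimum is over all ordinal mechanisms. **Mechanism RSBS (Random Survivors with burning and stealing).** Fix for every $\mathbf b$ an agent $i^*$ with $b_{i^*}=b_{\max}$, and put $y=b_{\max}/m$, $p_i=1-\frac{b_i-1}{3m}$, $$\beta_i=1-\frac{1-e^{-1+y}}{(1-y)\,p_i\int_0^1\prod_{j\ne i,i^*}\bigl(1-\tfrac{p_jb_j}{m}t\bigr)\,dt}\quad(i\neq i^*),\qquad \sigma=\frac{1-(2-y)e^{-1+y}}{1-e^{-1+y}}$$ (with $\sigma:=0$ if $n=1$). Phase 1: each agent $i\ne i^*$ is a survivor independently with probability $p_i$; each item, independently of the others, is given to a uniformly random one of the survivors that have it as a favorite, if there are any. Phase 2: each agent $i\neq i^*$,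 independently with probability $\beta_i$, loses all items she received in phase 1. Phase 3: agent $i^*$ gets all her favorite items that are unassigned and, with probability $\sigma$ (one independent coin), also all her favorite items that are assigned to other agents. Remaining items stay unassigned. **Theorem.** For every choice of the agents $i^*$, the following holds. 1. RSBS is well-defined: for every $\mathbf b$, $p_i\in(0,1]$ for all $i$, $\beta_i\in[0,1)$ for all $i\ne i^*$, and $\sigma\in[0,1)$. 2. For every $\mathbf b$, $\displaystyle \mathrm{dist}(\mathrm{RSBS},\mathbf b)\le\Bigl(1-\bigl(1-\tfrac{b_{\max}}m\bigr)e^{-1+b_{\max}/m}\Bigr)^{-1}$. 3. $\mathrm{dist}(\mathrm{RSBS})\le \frac{e}{e-1}$. 4. For every $\mathbf b$, $\mathrm{dist}(\mathrm{RSBS},\mathbf b)/\mathrm{dist}^*(\mathbf b)\le G(b_{\max}/m)$, where $$G(y)=\frac{1-(1-y)^{\lfloor 1/y\rfloor}\lfloor 1/y\rfloor\, y}{1-(1-y)e^{-1+y}}.$$ The maximum of $G$ on $(0,1]$ is attained at $y=1/2$, and $G(1/2)=\frac34\cdot\frac{2\sqrt e}{2\sqrt e-1}$. 5. $\mathrm{distgap}(\mathrm{RSBS})\le\frac34\cdot\frac{2\sqrt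 e}{2\sqrt e-1}$, and $\mathrm{distgap}(\mathrm{RSBS})\le 1.0765$. -/

import Mathlib

open MeasureTheory
open scoped NNReal ENNReal

noncomputable section

namespace BMatching

/-! ### Finite probability -/

/-- The law of a family of independent random variables, the `i`-th one having law `p i`. -/
def independent {ι α : Type} [Fintype ι] [DecidableEq ι] [Fintype α] (p : ι → PMF α) :
    PMF (ι → α) :=
  PMF.ofFintype (fun f => ∏ i, p i (f i)) (by
    classical
    have h := Finset.prod_univ_sum (fun _ : ι => (Finset.univ : Finset α)) (fun i a => p i a)
    rw [Fintype.piFinset_univ] at h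
    rw [← h]
    refine Finset.prod_eq_one fun i _ => ?_
    have h1 := (p i).tsum_coe
    rwa [tsum_fintype] at h1)

/-- A coin with success probability `p`; the truncation to `[0, 1]` is inactive for `p ∈ [0, 1]`. -/
def coin (p : ℝ) : PMF Bool :=
  PMF.ofFintype (fun x => cond x (min (ENNReal.ofReal p) 1) (1 - min (ENNReal.ofReal p) 1)) (by
    simp)

/-! ### Instances, rankings and matchings -/

/-- A quota vector `b = (b_1, …, b_n)` of positive integers, for `n ≥ 1` agents. -/
structure Quota where
  n : ℕ
  n_pos : 0 < n
  b : Fin n → ℕ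
  b_pos : ∀ i, 0 < b i

namespace Quota

/-- The number of items, `m = ∑ i, b i`. -/
def m (Q : Quota) : ℕ := ∑ i, Q.b i

/-- The largest quota. -/
def bmax (Q : Quota) : ℕ := Finset.univ.sup Q.b

/-- The ratio `b_max / m`. -/
def ratio (Q : Quota) : ℝ := (Q.bmax : ℝ) / (Q.m : ℝ)

end Quota

/-- A strict ranking of `m` items: `r g` is the position of item `g`, position `0` being the
most preferred one. -/
abbrev Ranking (m : ℕ) : Type := Equiv.Perm (Fin m)

/-- The set of the `k` top-ranked items. -/
def Ranking.top {m : ℕ} (r : Ranking m) (k : ℕ) : Finset (Fin m) :=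
  Finset.univ.filter fun g => (r g : ℕ) < k

/-- An ordinal preference profile. -/
abbrev PrefProfile (Q : Quota) : Type := Fin Q.n → Ranking Q.m

/-- The favorite items of agent `i`: her `b i` top-ranked items. -/
def favorites {Q : Quota} (R : PrefProfile Q) (i : Fin Q.n) : Finset (Fin Q.m) :=
  (R i).top (Q.b i)

/-- An assignment of items to agents: every item goes to at most one agent. -/
abbrev Assignment (Q : Quota) : Type := Fin Q.m → Option (Fin Q.n)

/-- The set of items that agent `i` gets. -/
def bundle {Q : Quota} (a : Assignment Q) (i : Fin Q.n) : Finset (Fin Q.m) :=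
  Finset.univ.filter fun g => a g = some i

/-- A matching: every agent `i` gets at most `b i` items. -/
def IsMatching {Q : Quota} (a : Assignment Q) : Prop :=
  ∀ i, (bundle a i).card ≤ Q.b i

/-! ### Valuations and welfare -/

/-- A valuation vector: non-negative values for the `m` items. -/
abbrev Valuation (m : ℕ) : Type := Fin m → ℝ≥0

/-- A valuation profile. -/
abbrev ValuationProfile (Q : Quota) : Type := Fin Q.n → Valuation Q.m

/-- The social welfare of an assignment. -/
def welfare {Q : Quota} (a : Assignment Q) (V : ValuationProfile Q) : ℝ≥0∞ :=
  ∑ i, ∑ g ∈ bundle a i, (V i g : ℝ≥0∞)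

/-- The optimal social welfare, i.e. the maximum welfare over all matchings. -/
def optWelfare {Q : Quota} (V : ValuationProfile Q) : ℝ≥0∞ :=
  ⨆ (a : Assignment Q) (_ : IsMatching a), welfare a V

/-- The rankings that are consistent with a valuation vector. -/
def consistent {m : ℕ} (v : Valuation m) : Finset (Ranking m) :=
  by
    classical
    exact Finset.univ.filter fun r => ∀ g h, v h < v g → r g < r h

theorem consistent_nonempty {m : ℕ} (v : Valuation m) : (consistent v).Nonempty := by
  classical
  refine ⟨(Tuple.sort fun g => OrderDual.toDual (v g)).symm, ?_⟩
  simp only [consistent, Finset.mem_filter, Finset.mem_univ, true_and]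
  intro g h hgh
  by_contra hlt
  have hmono := Tuple.monotone_sort (fun g => OrderDual.toDual (v g)) (not_lt.mp hlt)
  simp only [Function.comp_apply, Equiv.apply_symm_apply, OrderDual.toDual_le_toDual] at hmono
  exact absurd hgh (not_lt.mpr hmono)

/-- The random ranking induced by a valuation vector, ties being resolved uniformly at random. -/
def randomRanking {m : ℕ} (v : Valuation m) : PMF (Ranking m) :=
  PMF.uniformOfFinset (consistent v) (consistent_nonempty v)

/-- The random ordinal preference profile `P(V)`; ties are resolved independently across agents. -/
def randomProfile {Q : Quota} (V : ValuationProfile Q) : PMF (PrefProfile Q) :=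
  independent fun i => randomRanking (V i)

/-- The probability that `B` is the set of the `k` top-ranked items of an agent whose valuation
vector is drawn from `F`. -/
def topProb {m : ℕ} (F : Measure (Valuation m)) (k : ℕ) (B : Finset (Fin m)) : ℝ≥0∞ :=
  ∫⁻ v, ((randomRanking v).map fun r => r.top k) B ∂F

/-- Unbiased-favorites distributions, for an agent with quota `k`: all bundles of `k` items are
equally likely to be the favorite bundle. -/
def UnbiasedFavorites {m : ℕ} (F : Measure (Valuation m)) (k : ℕ) : Prop :=
  ∀ B C : Finset (Fin m), B.card = k → C.card = k → topProb F k B = topProb F k C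

/-! ### Mechanisms and distortion -/

/-- A (possibly randomized) ordinal matching mechanism. -/
structure Mechanism where
  /-- The law of the output, on a quota vector and an ordinal preference profile. -/
  run : (Q : Quota) → PrefProfile Q → PMF (Assignment Q)
  /-- The output is always a matching. -/
  isMatching : ∀ Q R, ∀ a ∈ (run Q R).support, IsMatching a

/-- The expected optimal welfare when the agents draw their valuation vectors independently,
agent `i` from `F i`. -/
def expectedOpt {Q : Quota} (F : Fin Q.n → ProbabilityMeasure (Valuation Q.m)) : ℝ≥0∞ :=
  ∫⁻ V : ValuationProfile Q, optWelfare V ∂(Measure.pi fun i => (F i : Measure (Valuation Q.m)))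

/-- The expected welfare of a mechanism, over the valuations, the tie-breaking and the randomness
of the mechanism. -/
def expectedWelfare (M : Mechanism) {Q : Quota}
    (F : Fin Q.n → ProbabilityMeasure (Valuation Q.m)) : ℝ≥0∞ :=
  ∫⁻ V : ValuationProfile Q, ∑ a, ((randomProfile V).bind (M.run Q)) a * welfare a V
    ∂(Measure.pi fun i => (F i : Measure (Valuation Q.m)))

/-- The distortion of a mechanism on the quota vector `Q`. In `ℝ≥0∞` one has `x / 0 = ∞` for
`x ≠ 0`, while the meaningless ratios `0 / 0` and `∞ / ∞` are `0` and do not affect the supremum. -/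
def distortionOn (M : Mechanism) (Q : Quota) : ℝ≥0∞ :=
  ⨆ (F : Fin Q.n → ProbabilityMeasure (Valuation Q.m))
    (_ : ∀ i, UnbiasedFavorites (F i : Measure (Valuation Q.m)) (Q.b i)),
    expectedOpt F / expectedWelfare M F

/-- The distortion of a mechanism. -/
def distortion (M : Mechanism) : ℝ≥0∞ := ⨆ Q, distortionOn M Q

/-- The best distortion that an ordinal matching mechanism can have on the quota vector `Q`. -/
def bestDistortionOn (Q : Quota) : ℝ≥0∞ := ⨅ M : Mechanism, distortionOn M Q

/-- The distortion gap of a mechanism. -/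
def distortionGap (M : Mechanism) : ℝ≥0∞ := ⨆ Q, distortionOn M Q / bestDistortionOn Q

/-! ### The mechanism RSBS

Throughout, `s` is the agent of largest quota that the mechanism sets aside. -/

/-- The survival probability of agent `i`. -/
def survivalProb (Q : Quota) (i : Fin Q.n) : ℝ := 1 - ((Q.b i : ℝ) - 1) / (3 * (Q.m : ℝ))

/-- The burning probability of agent `i ≠ s`. -/
def burningProb (Q : Quota) (s i : Fin Q.n) : ℝ :=
  1 - (1 - Real.exp (-1 + Q.ratio)) /
    ((1 - Q.ratio) * survivalProb Q i *
      ∫ y in (0 : ℝ)..1, ∏ j ∈ Finset.univ \ {i, s},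
        (1 - survivalProb Q j * (Q.b j : ℝ) / (Q.m : ℝ) * y))

/-- The stealing probability. If there is only one agent then this is `0 / 0 = 0`; in that case
there is never anything to steal. -/
def stealingProb (Q : Quota) : ℝ :=
  (1 - (2 - Q.ratio) * Real.exp (-1 + Q.ratio)) / (1 - Real.exp (-1 + Q.ratio))

/-- A uniformly random member of `D`, and `none` if `D` is empty. -/
def uniformMember {α : Type} (D : Finset α) : PMF (Option α) :=
  if h : D.Nonempty then (PMF.uniformOfFinset D h).map some else PMF.pure none

/-- The agents among which item `g` is raffled in phase 1: the survivors other than `s` who have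
`g` as a favorite. -/
def contenders {Q : Quota} (R : PrefProfile Q) (s : Fin Q.n) (surv : Fin Q.n → Bool)
    (g : Fin Q.m) : Finset (Fin Q.n) :=
  Finset.univ.filter fun i => i ≠ s ∧ surv i = true ∧ g ∈ favorites R i

/-- Phase 1 (random survivors): draw the survivors, then raffle every item among its contenders. -/
def phaseOne {Q : Quota} (R : PrefProfile Q) (s : Fin Q.n) : PMF (Assignment Q) :=
  (independent fun i => coin (survivalProb Q i)).bind fun surv =>
    independent fun g => uniformMember (contenders R s surv g)

/-- Phase 2 (burning): with probability `burningProb Q s i`, agent `i` loses all her items. -/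
def phaseTwo {Q : Quota} (s : Fin Q.n) (a : Assignment Q) : PMF (Assignment Q) :=
  (independent fun i => coin (burningProb Q s i)).map fun burn g =>
    (a g).filter fun i => !burn i

/-- Phase 3 (stealing): agent `s` gets her unassigned favorite items and, with probability
`stealingProb Q`, also all her other favorite items. -/
def phaseThree {Q : Quota} (R : PrefProfile Q) (s : Fin Q.n) (a : Assignment Q) :
    PMF (Assignment Q) :=
  (coin (stealingProb Q)).map fun steal g =>
    if g ∈ favorites R s ∧ (a g = none ∨ steal = true) then some s else a g

theorem mem_favorites_of_phaseOne {Q : Quota} {R : PrefProfile Q} {s : Fin Q.n}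
    {a : Assignment Q} (ha : a ∈ (phaseOne R s).support) {g : Fin Q.m} {i : Fin Q.n}
    (h : a g = some i) : g ∈ favorites R i := by
  classical
  rw [phaseOne, PMF.mem_support_bind_iff] at ha
  obtain ⟨surv, -, ha⟩ := ha
  rw [PMF.mem_support_iff, independent, PMF.ofFintype_apply, Finset.prod_ne_zero_iff] at ha
  have hg := ha g (Finset.mem_univ _)
  rw [← PMF.mem_support_iff, uniformMember, h] at hg
  split_ifs at hg with hD
  · rw [PMF.mem_support_map_iff] at hg
    obtain ⟨j, hj, hji⟩ := hg
    rw [PMF.mem_support_uniformOfFinset_iff] at hj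
    obtain rfl : j = i := Option.some.inj hji
    simp only [contenders, Finset.mem_filter] at hj
    exact hj.2.2.2
  · simp at hg

theorem card_top_le {m : ℕ} (r : Ranking m) (k : ℕ) : (r.top k).card ≤ k := by
  have : (r.top k).card ≤ (Finset.range k).card := by
    refine Finset.card_le_card_of_injOn (fun g => (r g : ℕ)) ?_ ?_
    · intro g hg
      simpa [Ranking.top] using hg
    · intro g _ h _ hgh
      exact r.injective (Fin.ext hgh)
  simpa using this

/-- The mechanism RSBS (random survivors with burning and stealing), where `sel Q` is the agent
that is set aside. -/
def RSBS (sel : (Q : Quota) → Fin Q.n) : Mechanism where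
  run Q R := ((phaseOne R (sel Q)).bind (phaseTwo (sel Q))).bind (phaseThree R (sel Q))
  isMatching Q R a ha i := by
    rw [PMF.mem_support_bind_iff] at ha
    obtain ⟨a₂, ha₂, ha⟩ := ha
    rw [PMF.mem_support_bind_iff] at ha₂
    obtain ⟨a₁, ha₁, ha₂⟩ := ha₂
    rw [phaseTwo, PMF.mem_support_map_iff] at ha₂
    obtain ⟨burn, -, rfl⟩ := ha₂
    rw [phaseThree, PMF.mem_support_map_iff] at ha
    obtain ⟨steal, -, rfl⟩ := ha
    refine le_trans (Finset.card_le_card ?_) (card_top_le (R i) (Q.b i))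
    intro g hg
    simp only [bundle, Finset.mem_filter, Finset.mem_univ, true_and] at hg
    split_ifs at hg with h
    · obtain rfl := Option.some.inj hg
      exact h.1
    · rw [Option.filter_eq_some_iff] at hg
      exact mem_favorites_of_phaseOne ha₁ hg.1

/-- The bound on the distortion gap of RSBS as a function of the ratio `y = b_max / m`. -/
def gapBound (y : ℝ) : ℝ :=
  (1 - (1 - y) ^ ⌊1 / y⌋₊ * (⌊1 / y⌋₊ : ℝ) * y) / (1 - (1 - y) * Real.exp (-1 + y))

end BMatching

end

/-! Write y = b_max/m, c_j = b_j/m, A = 1 - e^(-1+y), D = 1 - (1-y) e^(-1+y), and let s be the agent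
set aside.

Upper bound. OPT is at most the sum of the agents' values for their favorite items, and a mechanism
sees values only through rankings. So it suffices that each agent i, conditionally on her ranking,
gets each of her favorite items with probability at least D (`le_expect_assignProb`). Unbiasedness
enters only through the fact that a given item is a favorite of j with probability c_j
(`expect_mem_top`). Writing 1/k as the integral of t^(k-1) over [0,1] turns the chance in the raffle
into a product over independent agents: i ≠ s wins a favorite item in phase 1 with probability p_i ∫
∏ (1 - p_j c_j t) dt, j ranging over the agents other than i and s. Burning lowers this to A/(1-y)
for every i, and σ is the value for which (A/(1-y))(1 - σy), the probability for i, and 1 - (1-σ)A,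
the one for s, both equal D.

Burning is possible only if phase 1 gives at least A/(1-y), which is the integral of e^(-(1-y)t)
over [0,1]. This is the analytic core, `expMoment_zero_le`: compare logarithms pointwise, linearize
the exponential of the difference, and integrate against e^(-(1-y)t), which leaves linear
inequalities between truncated moments of the exponential law.

Lower bound. Let each agent have value 1/ε on a uniformly random bundle with probability ε, and
value 0 otherwise. Rankings are uniform whatever ε is, and a mechanism earns at most m(1 - ∏ (1 -
c_i)), since an item is wasted unless some agent has it as a favorite. As ε → 0 at most one agent
typically matters and E[OPT] tends to m. With c_i ≤ y and ∑ c_i = 1, the product is smallest for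
⌊1/y⌋ copies of y and one remainder (`pow_mul_le_prod_one_sub`), which gives the numerator of G.
What remains is to maximize G, done separately for ⌊1/y⌋ equal to 1, 2 and at least 3. -/

noncomputable section

namespace BMatching

/-! ### Real expectations over finite types -/

section Expectation

variable {α β : Type} [Fintype α] [Fintype β]

/-- The expectation of a real function on a finite type. -/
def expect (p : PMF α) (f : α → ℝ) : ℝ := ∑ a, (p a).toReal * f a

theorem sum_toReal (p : PMF α) : ∑ a, (p a).toReal = 1 := by
  rw [← ENNReal.toReal_sum fun a _ => p.apply_ne_top a, ← tsum_fintype (L := .unconditional _),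
    p.tsum_coe, ENNReal.toReal_one]

theorem expect_const (p : PMF α) (c : ℝ) : expect p (fun _ => c) = c := by
  rw [expect, ← Finset.sum_mul, sum_toReal, one_mul]

theorem expect_mono (p : PMF α) {f g : α → ℝ} (h : ∀ a, f a ≤ g a) : expect p f ≤ expect p g :=
  Finset.sum_le_sum fun a _ => mul_le_mul_of_nonneg_left (h a) ENNReal.toReal_nonneg

theorem expect_nonneg (p : PMF α) {f : α → ℝ} (h : ∀ a, 0 ≤ f a) : 0 ≤ expect p f :=
  Finset.sum_nonneg fun a _ => mul_nonneg ENNReal.toReal_nonneg (h a)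

theorem expect_sub (p : PMF α) (f g : α → ℝ) :
    expect p (fun a => f a - g a) = expect p f - expect p g := by
  simp only [expect, mul_sub, Finset.sum_sub_distrib]

theorem expect_sum {ι : Type} (p : PMF α) (S : Finset ι) (f : ι → α → ℝ) :
    expect p (fun a => ∑ i ∈ S, f i a) = ∑ i ∈ S, expect p (f i) := by
  simp only [expect, Finset.mul_sum]
  exact Finset.sum_comm

theorem expect_mul_left (p : PMF α) (c : ℝ) (f : α → ℝ) :
    expect p (fun a => c * f a) = c * expect p f := by
  simp only [expect, Finset.mul_sum]
  exact Finset.sum_congr rfl fun a _ => by ring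

theorem expect_mul_right (p : PMF α) (c : ℝ) (f : α → ℝ) :
    expect p (fun a => f a * c) = expect p f * c := by
  simp only [expect, Finset.sum_mul]
  exact Finset.sum_congr rfl fun a _ => by ring

theorem expect_pure (a : α) (f : α → ℝ) : expect (PMF.pure a) f = f a := by
  classical
  rw [expect, Finset.sum_eq_single a]
  · simp
  · intro b _ hb
    simp [PMF.pure_apply, hb]
  · simp

theorem expect_bind (p : PMF α) (k : α → PMF β) (f : β → ℝ) :
    expect (p.bind k) f = expect p fun a => expect (k a) f := by
  simp only [expect, PMF.bind_apply, tsum_fintype, Finset.mul_sum]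
  rw [Finset.sum_comm]
  refine Finset.sum_congr rfl fun b _ => ?_
  rw [ENNReal.toReal_sum fun a _ => ENNReal.mul_ne_top (p.apply_ne_top a) ((k a).apply_ne_top b),
    Finset.sum_mul]
  exact Finset.sum_congr rfl fun a _ => by rw [ENNReal.toReal_mul, mul_assoc]

theorem expect_map (p : PMF α) (g : α → β) (f : β → ℝ) :
    expect (p.map g) f = expect p fun a => f (g a) := by
  rw [PMF.map, expect_bind]
  simp only [Function.comp_apply, expect_pure]

theorem expect_indicator (p : PMF α) [DecidableEq α] (a : α) :
    expect p (fun b => if b = a then 1 else 0) = (p a).toReal := by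
  simp [expect]

theorem expect_independent_prod {ι : Type} [Fintype ι] [DecidableEq ι] (p : ι → PMF α)
    (h : ι → α → ℝ) :
    expect (independent p) (fun f => ∏ i, h i (f i)) = ∏ i, expect (p i) (h i) := by
  classical
  simp only [expect, independent, PMF.ofFintype_apply, ENNReal.toReal_prod,
    ← Finset.prod_mul_distrib]
  rw [Finset.prod_univ_sum, Fintype.piFinset_univ]

theorem expect_independent_apply {ι : Type} [Fintype ι] [DecidableEq ι] (p : ι → PMF α) (i : ι)
    (h : α → ℝ) : expect (independent p) (fun f => h (f i)) = expect (p i) h := by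
  have := expect_independent_prod p fun j a => if j = i then h a else 1
  simp only [Finset.prod_ite_eq', Finset.mem_univ, if_true] at this
  rw [this, Finset.prod_eq_single i]
  · simp
  · intro j _ hj
    simp [hj, expect_const]
  · simp

theorem expect_coin {p : ℝ} (hp : p ∈ Set.Icc (0 : ℝ) 1) (f : Bool → ℝ) :
    expect (coin p) f = p * f true + (1 - p) * f false := by
  have h1 : min (ENNReal.ofReal p) 1 = ENNReal.ofReal p :=
    min_eq_left (ENNReal.ofReal_le_one.2 hp.2)
  have h2 : (1 - ENNReal.ofReal p).toReal = 1 - p := by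
    rw [ENNReal.toReal_sub_of_le (ENNReal.ofReal_le_one.2 hp.2) ENNReal.one_ne_top,
      ENNReal.toReal_ofReal hp.1, ENNReal.toReal_one]
  simp [expect, coin, h1, h2, ENNReal.toReal_ofReal hp.1]

theorem expect_uniformMember [DecidableEq α] (D : Finset α) (i : α) :
    expect (uniformMember D) (fun o => if o = some i then 1 else 0) =
      if i ∈ D then ((D.card : ℝ))⁻¹ else 0 := by
  classical
  unfold uniformMember
  split_ifs with hD hi hi
  · rw [expect_map]
    simp only [Option.some.injEq]
    rw [expect_indicator, PMF.uniformOfFinset_apply, if_pos hi]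
    simp
  · rw [expect_map]
    simp only [Option.some.injEq]
    rw [expect_indicator, PMF.uniformOfFinset_apply, if_neg hi]
    simp
  · exact absurd ⟨i, hi⟩ hD
  · rw [expect_pure]
    simp

theorem expect_integral (p : PMF α) (f : α → ℝ → ℝ) (hf : ∀ a, Continuous (f a)) :
    expect p (fun a => ∫ t in (0 : ℝ)..1, f a t) = ∫ t in (0 : ℝ)..1, expect p fun a => f a t := by
  simp only [expect]
  rw [intervalIntegral.integral_finsetSum]
  · simp only [intervalIntegral.integral_const_mul]
  · intro a _
    exact ((hf a).const_mul _ |>.intervalIntegrable _ _)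

end Expectation

/-! ### The law of RSBS -/

section RSBS

variable {Q : Quota}

/-- The probability that phase 1 gives item `g` to agent `i`. -/
def phaseOneProb (R : PrefProfile Q) (s : Fin Q.n) (g : Fin Q.m) (i : Fin Q.n) : ℝ :=
  expect (phaseOne R s) fun a => if a g = some i then 1 else 0

theorem phaseOneProb_eq (R : PrefProfile Q) (s : Fin Q.n) (g : Fin Q.m) (i : Fin Q.n) :
    phaseOneProb R s g i = expect (independent fun j => coin (survivalProb Q j)) fun surv =>
      if i ∈ contenders R s surv g then (((contenders R s surv g).card : ℝ))⁻¹ else 0 := by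
  rw [phaseOneProb, phaseOne, expect_bind]
  congr 1
  funext surv
  rw [expect_independent_apply (fun g => uniformMember (contenders R s surv g)) g
    fun o => if o = some i then 1 else 0, expect_uniformMember]

/-- The integrand is t^(|D|-1). The index set `T` may exceed `D.erase i`, so that it can be kept
fixed while `D` is random; independence then applies to the product. -/
theorem inv_card_eq_integral {α : Type} [DecidableEq α] {D T : Finset α} {i : α}
    (hi : i ∈ D) (hT : D.erase i ⊆ T) (hiT : i ∉ T) :
    ((D.card : ℝ))⁻¹ = ∫ t in (0 : ℝ)..1, ∏ j ∈ T, if j ∈ D then t else 1 := by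
  have h1 : ∀ t : ℝ, (∏ j ∈ T, if j ∈ D then t else 1) = t ^ (D.card - 1) := by
    intro t
    rw [Finset.prod_ite, Finset.prod_const_one, mul_one, Finset.prod_const]
    congr 1
    rw [← Finset.card_erase_of_mem hi]
    congr 1
    ext j
    simp only [Finset.mem_filter, Finset.mem_erase]
    constructor
    · rintro ⟨h1, h2⟩
      exact ⟨fun h => hiT (h ▸ h1), h2⟩
    · intro h
      exact ⟨hT (Finset.mem_erase.2 h), h.2⟩
  have hpos : 0 < D.card := Finset.card_pos.2 ⟨i, hi⟩
  simp only [h1, integral_pow]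
  have : ((D.card - 1 : ℕ) : ℝ) + 1 = D.card := by
    rw [Nat.cast_sub hpos]
    simp
  rw [this]
  simp

/-- The contribution of agent `j` to the generating function of the number of contenders. -/
def contenderFactor (s i : Fin Q.n) (g : Fin Q.m) (t : ℝ) (j : Fin Q.n) (r : Ranking Q.m)
    (x : Bool) : ℝ :=
  if j = i then (if x = true ∧ g ∈ r.top (Q.b j) then 1 else 0)
  else if j = s then 1 else if x = true ∧ g ∈ r.top (Q.b j) then t else 1

theorem continuous_contenderFactor (s i : Fin Q.n) (g : Fin Q.m) (j : Fin Q.n) (r : Ranking Q.m)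
    (x : Bool) : Continuous fun t => contenderFactor s i g t j r x := by
  unfold contenderFactor
  split_ifs <;> fun_prop

theorem contenders_eq_integral (R : PrefProfile Q) {s i : Fin Q.n} (his : i ≠ s) (g : Fin Q.m)
    (surv : Fin Q.n → Bool) :
    (if i ∈ contenders R s surv g then (((contenders R s surv g).card : ℝ))⁻¹ else 0) =
      ∫ t in (0 : ℝ)..1, ∏ j, contenderFactor s i g t j (R j) (surv j) := by
  have hmem : ∀ j, j ∈ contenders R s surv g ↔
      j ≠ s ∧ surv j = true ∧ g ∈ (R j).top (Q.b j) := by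
    intro j
    rw [contenders, Finset.mem_filter]
    simp only [Finset.mem_univ, true_and, favorites]
  split_ifs with hi
  · rw [inv_card_eq_integral (T := Finset.univ.erase i) hi (by
      intro j hj
      exact Finset.mem_erase.2 ⟨(Finset.mem_erase.1 hj).1, Finset.mem_univ _⟩) (by simp)]
    congr 1
    funext t
    rw [← Finset.mul_prod_erase _ _ (Finset.mem_univ i)]
    have h1 : contenderFactor s i g t i (R i) (surv i) = 1 := by
      rw [contenderFactor, if_pos rfl, if_pos ((hmem i).1 hi).2]
    rw [h1, one_mul]
    refine Finset.prod_congr rfl fun j hj => ?_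
    rw [contenderFactor, if_neg (Finset.mem_erase.1 hj).1]
    by_cases hjs : j = s
    · rw [if_pos hjs, if_neg fun h => ((hmem j).1 h).1 hjs]
    · rw [if_neg hjs]
      simp only [hmem, ne_eq, hjs, not_false_eq_true, true_and]
  · have h0 : ∀ t : ℝ, ∏ j, contenderFactor s i g t j (R j) (surv j) = 0 := by
      intro t
      refine Finset.prod_eq_zero (Finset.mem_univ i) ?_
      rw [contenderFactor, if_pos rfl, if_neg fun h => hi ((hmem i).2 ⟨his, h⟩)]
    simp [h0]

theorem expect_factor (P : PMF (Ranking Q.m)) (x : ℝ) (j : Fin Q.n) (g : Fin Q.m) (a b : ℝ)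
    (hx : expect P (fun r => if g ∈ r.top (Q.b j) then 1 else 0) = x)
    (hp : survivalProb Q j ∈ Set.Icc (0 : ℝ) 1) :
    expect P (fun r => expect (coin (survivalProb Q j)) fun z =>
      if z = true ∧ g ∈ r.top (Q.b j) then a else b) =
      b + survivalProb Q j * x * (a - b) := by
  have h : ∀ r : Ranking Q.m, (expect (coin (survivalProb Q j)) fun z =>
      if z = true ∧ g ∈ r.top (Q.b j) then a else b) =
      b - (survivalProb Q j * (b - a)) * (if g ∈ r.top (Q.b j) then 1 else 0) := by
    intro r
    rw [expect_coin hp]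
    by_cases hg : g ∈ r.top (Q.b j)
    · simp only [hg, and_self, if_true, Bool.false_eq_true, false_and, if_false]
      ring
    · simp only [hg, and_false, if_false]
      ring
  simp only [h]
  rw [expect_sub, expect_const, expect_mul_left, hx]
  ring

/-- The probability that phase 1 gives item `g` to agent `i`, times a function of the ranking of
agent `s`, averaged over independent rankings. -/
theorem expect_phaseOneProb (hp : ∀ j, survivalProb Q j ∈ Set.Icc (0 : ℝ) 1)
    (P : Fin Q.n → PMF (Ranking Q.m)) {s i : Fin Q.n} (his : i ≠ s) (g : Fin Q.m)
    (x : Fin Q.n → ℝ)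
    (hx : ∀ j, j ≠ s → expect (P j) (fun r => if g ∈ r.top (Q.b j) then 1 else 0) = x j)
    (h : Ranking Q.m → ℝ) :
    expect (independent P) (fun R => phaseOneProb R s g i * h (R s)) =
      survivalProb Q i * x i * expect (P s) h *
        ∫ y in (0 : ℝ)..1, ∏ j ∈ Finset.univ \ {i, s}, (1 - survivalProb Q j * x j * y) := by
  have hcont : ∀ (R : PrefProfile Q) (surv : Fin Q.n → Bool),
      Continuous fun t => ∏ j, contenderFactor s i g t j (R j) (surv j) := fun R surv =>
    continuous_finsetProd _ fun j _ => continuous_contenderFactor s i g j (R j) (surv j)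
  have h1 : ∀ R : PrefProfile Q, phaseOneProb R s g i = ∫ t in (0 : ℝ)..1,
      ∏ j, expect (coin (survivalProb Q j)) fun z => contenderFactor s i g t j (R j) z := by
    intro R
    rw [phaseOneProb_eq]
    simp only [contenders_eq_integral R his g]
    rw [expect_integral _ _ (hcont R)]
    congr 1
    funext t
    exact expect_independent_prod _ fun j z => contenderFactor s i g t j (R j) z
  -- The weight is absorbed into the factor of agent `s`, which is 1 in the raffle, so the integrand
  -- remains a product of functions of independent rankings.
  have h2 : ∀ R : PrefProfile Q, phaseOneProb R s g i * h (R s) = ∫ t in (0 : ℝ)..1,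
      ∏ j, (expect (coin (survivalProb Q j)) fun z => contenderFactor s i g t j (R j) z) *
        if j = s then h (R j) else 1 := by
    intro R
    rw [h1, ← intervalIntegral.integral_mul_const]
    congr 1
    funext t
    rw [Finset.prod_mul_distrib]
    congr 1
    rw [Finset.prod_ite_eq' Finset.univ s]
    simp
  simp only [h2]
  rw [expect_integral]
  · have h3 : ∀ t : ℝ, (expect (independent P) fun R => ∏ j,
        (expect (coin (survivalProb Q j)) fun z => contenderFactor s i g t j (R j) z) *
          if j = s then h (R j) else 1) =
        survivalProb Q i * x i * expect (P s) h *
          ∏ j ∈ Finset.univ \ {i, s}, (1 - survivalProb Q j * x j * (1 - t)) := by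
      intro t
      rw [expect_independent_prod P fun j r =>
        (expect (coin (survivalProb Q j)) fun z => contenderFactor s i g t j r z) *
          if j = s then h r else 1]
      rw [← Finset.prod_sdiff (Finset.subset_univ {i, s}), Finset.prod_pair his, mul_comm]
      congr 1
      · congr 1
        · simp only [contenderFactor, if_true, his, if_false, mul_one]
          rw [expect_factor (P i) (x i) i g 1 0 (hx i his) (hp i)]
          ring
        · simp only [contenderFactor, his.symm, if_true, if_false, expect_const, one_mul]
      · refine Finset.prod_congr rfl fun j hj => ?_
        simp only [Finset.mem_sdiff, Finset.mem_univ, true_and, Finset.mem_insert,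
          Finset.mem_singleton, not_or] at hj
        simp only [contenderFactor, hj.1, hj.2, if_false, mul_one]
        rw [expect_factor (P j) (x j) j g t 1 (hx j hj.2) (hp j)]
        ring
    simp only [h3]
    rw [intervalIntegral.integral_const_mul]
    congr 1
    -- A competitor contributes t when she contends and 1 otherwise, on average 1 - p x (1 - t); the
    -- substitution y = 1 - t gives the stated integral.
    rw [intervalIntegral.integral_comp_sub_left
      (fun y => ∏ j ∈ Finset.univ \ {i, s}, (1 - survivalProb Q j * x j * y)) 1]
    simp
  · intro R
    refine continuous_finsetProd _ fun j _ => Continuous.mul ?_ continuous_const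
    exact continuous_finsetSum _ fun z _ =>
      continuous_const.mul (continuous_contenderFactor s i g j (R j) z)

/-- The outcome of RSBS for agents other than `s`. -/
theorem expect_run_eq_some {sel : (Q : Quota) → Fin Q.n} (R : PrefProfile Q) (g : Fin Q.m)
    {i : Fin Q.n} (his : i ≠ sel Q) (hβ : burningProb Q (sel Q) i ∈ Set.Icc (0 : ℝ) 1)
    (hσ : stealingProb Q ∈ Set.Icc (0 : ℝ) 1) :
    expect ((RSBS sel).run Q R) (fun a => if a g = some i then 1 else 0) =
      phaseOneProb R (sel Q) g i * ((1 - burningProb Q (sel Q) i) *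
        (1 - stealingProb Q * if g ∈ (R (sel Q)).top (Q.b (sel Q)) then 1 else 0)) := by
  -- Agent `i` ends up with the item exactly if phase 1 gave it to her, she is not burned, and `s`
  -- does not steal it. The indicator splits over the three independent sources of randomness.
  have hind : ∀ (a : Assignment Q) (burn : Fin Q.n → Bool) (st : Bool),
      (if (if g ∈ favorites R (sel Q) ∧ (((a g).filter fun j => !burn j) = none ∨ st = true)
        then some (sel Q) else (a g).filter fun j => !burn j) = some i then (1 : ℝ) else 0) =
      (if a g = some i then 1 else 0) * ((if burn i = true then 0 else 1) *
        (if g ∈ favorites R (sel Q) ∧ st = true then 0 else 1)) := by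
    intro a burn st
    cases hag : a g with
    | none =>
      simp [his.symm]
    | some j =>
      by_cases hji : j = i
      · subst hji
        cases hb : burn j <;> cases st <;> by_cases hg : g ∈ favorites R (sel Q) <;>
          simp [Option.filter, hb, hg, his.symm]
      · cases hb : burn j <;> cases st <;> by_cases hg : g ∈ favorites R (sel Q) <;>
          simp [Option.filter, hb, hg, his.symm, hji]
  have hst : (expect (coin (stealingProb Q)) fun st =>
      if g ∈ favorites R (sel Q) ∧ st = true then (0 : ℝ) else 1) =
      1 - stealingProb Q * if g ∈ (R (sel Q)).top (Q.b (sel Q)) then 1 else 0 := by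
    rw [expect_coin hσ]
    by_cases hg : g ∈ (R (sel Q)).top (Q.b (sel Q)) <;> simp [favorites, hg]
  have hbn : (expect (independent fun j => coin (burningProb Q (sel Q) j)) fun burn =>
      if burn i = true then (0 : ℝ) else 1) = 1 - burningProb Q (sel Q) i := by
    rw [expect_independent_apply (fun j => coin (burningProb Q (sel Q) j)) i
      fun z => if z = true then 0 else 1, expect_coin hβ]
    simp
  change expect (((phaseOne R (sel Q)).bind (phaseTwo (sel Q))).bind (phaseThree R (sel Q))) _ = _
  simp only [expect_bind, phaseTwo, phaseThree, expect_map, hind, expect_mul_left,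
    expect_mul_right, hst, hbn]
  rfl

/-- The outcome of RSBS for agent `s`. -/
theorem le_expect_run_eq_sel {sel : (Q : Quota) → Fin Q.n} (R : PrefProfile Q) (g : Fin Q.m)
    (hg : g ∈ (R (sel Q)).top (Q.b (sel Q)))
    (hβ : ∀ i, i ≠ sel Q → burningProb Q (sel Q) i ∈ Set.Icc (0 : ℝ) 1)
    (hσ : stealingProb Q ∈ Set.Icc (0 : ℝ) 1) :
    1 - (1 - stealingProb Q) * ∑ j ∈ Finset.univ.erase (sel Q),
        phaseOneProb R (sel Q) g j * (1 - burningProb Q (sel Q) j) ≤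
      expect ((RSBS sel).run Q R) (fun a => if a g = some (sel Q) then 1 else 0) := by
  -- A favorite item of `s` escapes her only if she does not steal and phase 1 gave it to another
  -- agent who is not burned.
  have hind : ∀ (a : Assignment Q) (burn : Fin Q.n → Bool) (st : Bool),
      1 - (∑ j ∈ Finset.univ.erase (sel Q), (if a g = some j then (1 : ℝ) else 0) *
        (if burn j = true then 0 else 1)) * (if st = true then 0 else 1) ≤
      (if (if g ∈ favorites R (sel Q) ∧ (((a g).filter fun j => !burn j) = none ∨ st = true)
        then some (sel Q) else (a g).filter fun j => !burn j) = some (sel Q)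
        then (1 : ℝ) else 0) := by
    intro a burn st
    have hg' : g ∈ favorites R (sel Q) := hg
    have hnn : 0 ≤ (∑ j ∈ Finset.univ.erase (sel Q), (if a g = some j then (1 : ℝ) else 0) *
        (if burn j = true then 0 else 1)) * (if st = true then 0 else 1) := by
      refine mul_nonneg (Finset.sum_nonneg fun j _ => mul_nonneg ?_ ?_) ?_ <;> split_ifs <;>
        norm_num
    cases st with
    | true => simp [hg']
    | false =>
      cases hf : (a g).filter fun j => !burn j with
      | none =>
        simp only [hg', true_and, true_or, if_true]
        linarith
      | some k =>
        by_cases hk : k = sel Q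
        · simp only [hk, reduceCtorEq, Bool.false_eq_true, or_self, and_false, if_false, if_true]
          simp only [Bool.false_eq_true, if_false] at hnn
          linarith
        · obtain ⟨hak, hbk⟩ := Option.filter_eq_some_iff.1 hf
          have hle := Finset.single_le_sum (s := Finset.univ.erase (sel Q))
            (f := fun j => (if a g = some j then (1 : ℝ) else 0) * (if burn j = true then 0 else 1))
            (fun j _ => by positivity) (Finset.mem_erase.2 ⟨hk, Finset.mem_univ k⟩)
          simp only [hak, if_true] at hle ⊢
          have hbk' : burn k = false := by simpa using hbk
          simp only [hbk', Bool.false_eq_true, if_false, mul_one] at hle ⊢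
          simp only [Option.some.injEq] at hle
          simp only [Option.some.injEq, hk, reduceCtorEq, or_self, and_false, if_false]
          linarith
  have hst : expect (coin (stealingProb Q)) (fun st => if st = true then (0 : ℝ) else 1) =
      1 - stealingProb Q := by
    rw [expect_coin hσ]
    simp
  have hbn : ∀ j, j ≠ sel Q → expect (independent fun j => coin (burningProb Q (sel Q) j))
      (fun burn => if burn j = true then (0 : ℝ) else 1) = 1 - burningProb Q (sel Q) j := by
    intro j hj
    rw [expect_independent_apply (fun j => coin (burningProb Q (sel Q) j)) j
      fun z => if z = true then 0 else 1, expect_coin (hβ j hj)]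
    simp
  change _ ≤ expect (((phaseOne R (sel Q)).bind (phaseTwo (sel Q))).bind
    (phaseThree R (sel Q))) _
  simp only [expect_bind, phaseTwo, phaseThree, expect_map]
  refine le_trans (le_of_eq ?_) (expect_mono _ fun a => expect_mono _ fun burn =>
    expect_mono _ fun st => hind a burn st)
  simp only [expect_sub, expect_const, expect_mul_left, expect_mul_right, expect_sum, hst]
  rw [mul_comm]
  congr 2
  refine Finset.sum_congr rfl fun j hj => ?_
  rw [hbn j (Finset.mem_erase.1 hj).1]
  rfl

end RSBS

/-! ### Reduction of the welfare to the laws of the rankings -/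

section Welfare

theorem randomRanking_apply {m : ℕ} (v : Valuation m) (r : Ranking m) :
    randomRanking v r = if r ∈ consistent v then ((consistent v).card : ℝ≥0∞)⁻¹ else 0 := by
  rw [randomRanking, PMF.uniformOfFinset_apply]
  congr

theorem measurable_randomRanking {m : ℕ} (r : Ranking m) :
    Measurable fun v : Valuation m => randomRanking v r := by
  have hset : ∀ r : Ranking m, MeasurableSet {v : Valuation m | r ∈ consistent v} := by
    intro r
    have : {v : Valuation m | r ∈ consistent v} =
        ⋂ g, ⋂ h, {v : Valuation m | v h < v g → r g < r h} := by
      ext v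
      simp [consistent]
    rw [this]
    refine MeasurableSet.iInter fun g => MeasurableSet.iInter fun h => ?_
    by_cases hr : r g < r h
    · simp [hr]
    · simp only [hr, imp_false, not_lt]
      exact measurableSet_le (measurable_pi_apply g) (measurable_pi_apply h)
  have hcard : ∀ v : Valuation m, ((consistent v).card : ℝ≥0∞) =
      ∑ r : Ranking m, {v : Valuation m | r ∈ consistent v}.indicator 1 v := by
    intro v
    classical
    simp [Set.indicator_apply]
  simp only [randomRanking_apply, hcard]
  exact Measurable.ite (hset r) (Finset.measurable_sum _ fun r _ =>
    measurable_one.indicator (hset r)).inv measurable_const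

/-- The law of the ranking of an agent whose valuation vector is drawn from `F`. -/
def rankingLaw {m : ℕ} (F : ProbabilityMeasure (Valuation m)) : PMF (Ranking m) :=
  PMF.ofFintype (fun r => ∫⁻ v, randomRanking v r ∂(F : Measure (Valuation m))) (by
    rw [← lintegral_finsetSum _ fun r _ => measurable_randomRanking r]
    have : ∀ v : Valuation m, ∑ r, randomRanking v r = 1 := by
      intro v
      rw [← tsum_fintype (L := .unconditional _), PMF.tsum_coe]
    simp [this])

/-- The expected value of item `g`, restricted to the event that the ranking is `r`. -/
def rankedValue {m : ℕ} (F : ProbabilityMeasure (Valuation m)) (r : Ranking m) (g : Fin m) :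
    ℝ≥0∞ :=
  ∫⁻ v, randomRanking v r * (v g : ℝ≥0∞) ∂(F : Measure (Valuation m))

theorem lintegral_pi_prod {ι Ω : Type} [Fintype ι] [MeasurableSpace Ω] (μ : ι → Measure Ω)
    [∀ i, IsProbabilityMeasure (μ i)] (f : ι → Ω → ℝ≥0∞) (hf : ∀ i, Measurable (f i)) :
    ∫⁻ x, ∏ i, f i (x i) ∂(Measure.pi μ) = ∏ i, ∫⁻ v, f i v ∂(μ i) := by
  have hind := ProbabilityTheory.iIndepFun_pi (μ := μ) (X := f) fun i => (hf i).aemeasurable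
  refine (ProbabilityTheory.lintegral_prod_eq_prod_lintegral_of_indepFun Finset.univ
    (fun i (x : ι → Ω) => f i (x i)) hind fun i => (hf i).comp (measurable_pi_apply i)).trans ?_
  refine Finset.prod_congr rfl fun i _ => ?_
  exact (measurePreserving_eval μ i).lintegral_comp (hf i)

theorem independent_apply {ι α : Type} [Fintype ι] [DecidableEq ι] [Fintype α] (p : ι → PMF α)
    (f : ι → α) : independent p f = ∏ i, p i (f i) := rfl

/-- The probability that the mechanism gives item `g` to agent `i`. -/
def assignProb (M : Mechanism) {Q : Quota} (R : PrefProfile Q) (i : Fin Q.n) (g : Fin Q.m) : ℝ :=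
  expect (M.run Q R) fun a => if a g = some i then 1 else 0

theorem sum_comm_four {α β γ δ : Type} [Fintype α] [Fintype β] [Fintype γ] [Fintype δ]
    (f : α → β → γ → δ → ℝ≥0∞) :
    ∑ a, ∑ b, ∑ c, ∑ d, f a b c d = ∑ b, ∑ c, ∑ d, ∑ a, f a b c d := by
  rw [Finset.sum_comm]
  refine Finset.sum_congr rfl fun b _ => ?_
  rw [Finset.sum_comm]
  exact Finset.sum_congr rfl fun c _ => Finset.sum_comm

theorem assignProb_nonneg (M : Mechanism) {Q : Quota} (R : PrefProfile Q) (i : Fin Q.n)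
    (g : Fin Q.m) : 0 ≤ assignProb M R i g :=
  expect_nonneg _ fun a => by split_ifs <;> norm_num

theorem ofReal_assignProb (M : Mechanism) {Q : Quota} (R : PrefProfile Q) (i : Fin Q.n)
    (g : Fin Q.m) : ENNReal.ofReal (assignProb M R i g) =
      ∑ a, M.run Q R a * if a g = some i then 1 else 0 := by
  rw [assignProb, expect, ENNReal.ofReal_sum_of_nonneg]
  · refine Finset.sum_congr rfl fun a _ => ?_
    split_ifs
    · rw [mul_one, mul_one, ENNReal.ofReal_toReal ((M.run Q R).apply_ne_top a)]
    · simp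
  · intro a _
    refine mul_nonneg ENNReal.toReal_nonneg ?_
    split_ifs <;> norm_num

/-- Given the rankings, the output does not depend on the values. Hence the values of agent `i`
enter only through `rankedValue`, and the other agents only through the laws of their rankings. -/
theorem expectedWelfare_eq (M : Mechanism) {Q : Quota}
    (F : Fin Q.n → ProbabilityMeasure (Valuation Q.m)) :
    expectedWelfare M F = ∑ i, ∑ g, ∑ R : PrefProfile Q,
      (∏ j ∈ Finset.univ.erase i, rankingLaw (F j) (R j)) * rankedValue (F i) (R i) g *
        ENNReal.ofReal (assignProb M R i g) := by
  classical
  have hpt : ∀ V : ValuationProfile Q,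
      ∑ a, ((randomProfile V).bind (M.run Q)) a * welfare a V = ∑ i, ∑ g, ∑ R : PrefProfile Q,
        (∏ j, (randomRanking (V j) (R j) * if j = i then (V j g : ℝ≥0∞) else 1)) *
          ENNReal.ofReal (assignProb M R i g) := by
    intro V
    have hprod : ∀ (i : Fin Q.n) (g : Fin Q.m) (R : PrefProfile Q),
        ∏ j, (randomRanking (V j) (R j) * if j = i then (V j g : ℝ≥0∞) else 1) =
          randomProfile V R * (V i g : ℝ≥0∞) := by
      intro i g R
      rw [Finset.prod_mul_distrib, Finset.prod_ite_eq' Finset.univ i, if_pos (Finset.mem_univ i)]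
      rfl
    have hwel : ∀ a : Assignment Q, welfare a V =
        ∑ i, ∑ g, if a g = some i then (V i g : ℝ≥0∞) else 0 := by
      intro a
      simp only [welfare, bundle, Finset.sum_filter]
    simp only [hprod, hwel, ofReal_assignProb, PMF.bind_apply, tsum_fintype, Finset.sum_mul,
      Finset.mul_sum]
    refine (sum_comm_four _).trans (Finset.sum_congr rfl fun i _ => Finset.sum_congr rfl fun g _ =>
      Finset.sum_congr rfl fun R _ => Finset.sum_congr rfl fun a _ => ?_)
    split_ifs
    · ring
    · simp
  rw [expectedWelfare]
  simp only [hpt]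
  have hmeas : ∀ (i : Fin Q.n) (g : Fin Q.m) (R : PrefProfile Q) (j : Fin Q.n), Measurable
      fun v : Valuation Q.m => randomRanking v (R j) * if j = i then (v g : ℝ≥0∞) else 1 := by
    intro i g R j
    refine (measurable_randomRanking _).mul ?_
    split_ifs
    · exact (measurable_pi_apply g).coe_nnreal_ennreal
    · exact measurable_const
  have hmeas' : ∀ (i : Fin Q.n) (g : Fin Q.m) (R : PrefProfile Q), Measurable
      fun V : ValuationProfile Q => ∏ j, (randomRanking (V j) (R j) *
        if j = i then (V j g : ℝ≥0∞) else 1) := fun i g R =>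
    Finset.measurable_prod _ fun j _ => (hmeas i g R j).comp (measurable_pi_apply j)
  rw [lintegral_finsetSum _ fun i _ => Finset.measurable_sum _ fun g _ =>
    Finset.measurable_sum _ fun R _ => (hmeas' i g R).mul_const _]
  refine Finset.sum_congr rfl fun i _ => ?_
  rw [lintegral_finsetSum _ fun g _ =>
    Finset.measurable_sum _ fun R _ => (hmeas' i g R).mul_const _]
  refine Finset.sum_congr rfl fun g _ => ?_
  rw [lintegral_finsetSum _ fun R _ => (hmeas' i g R).mul_const _]
  refine Finset.sum_congr rfl fun R _ => ?_
  rw [lintegral_mul_const _ (hmeas' i g R), lintegral_pi_prod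
    (fun i => (F i : Measure (Valuation Q.m))) (fun j v => randomRanking v (R j) *
      if j = i then (v g : ℝ≥0∞) else 1) (hmeas i g R),
    ← Finset.prod_erase_mul _ _ (Finset.mem_univ i)]
  congr 2
  · refine Finset.prod_congr rfl fun j hj => ?_
    simp only [(Finset.mem_erase.1 hj).1, if_false, mul_one]
    rfl
  · simp only [if_true]
    rfl

end Welfare

/-! ### Unbiased favorites and the favorite value -/

section Favorites

variable {m : ℕ}

theorem card_top (r : Ranking m) {k : ℕ} (hk : k ≤ m) : (r.top k).card = k := by
  have h : (r.top k).card = (Finset.univ.filter fun x : Fin m => (x : ℕ) < k).card :=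
    Finset.card_equiv r fun g => by simp [Ranking.top]
  rw [h, Fin.card_filter_val_lt]
  exact min_eq_right hk

theorem topProb_eq (F : ProbabilityMeasure (Valuation m)) (k : ℕ) (B : Finset (Fin m)) :
    topProb (F : Measure (Valuation m)) k B = (rankingLaw F).map (fun r => r.top k) B := by
  classical
  simp only [topProb, PMF.map_apply, tsum_fintype]
  rw [lintegral_finsetSum _ fun r _ => by
    split_ifs
    · exact measurable_randomRanking r
    · exact measurable_const]
  refine Finset.sum_congr rfl fun r _ => ?_
  split_ifs
  · rfl
  · simp

/-- Transposing two items preserves the law of the favorite set, so all items are equally likely to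
be in it; these m equal probabilities add up to its size k. -/
theorem expect_mem_top {F : ProbabilityMeasure (Valuation m)} {k : ℕ} (hk : k ≤ m)
    (hF : UnbiasedFavorites (F : Measure (Valuation m)) k) (g : Fin m) :
    expect (rankingLaw F) (fun r => if g ∈ r.top k then 1 else 0) = (k : ℝ) / m := by
  classical
  set μ := (rankingLaw F).map fun r => r.top k with hμ
  have hmap : ∀ g : Fin m, expect (rankingLaw F) (fun r => if g ∈ r.top k then 1 else 0) =
      expect μ fun B => if g ∈ B then 1 else 0 := fun g => by rw [hμ, expect_map]
  have hzero : ∀ B : Finset (Fin m), B.card ≠ k → μ B = 0 := by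
    intro B hB
    rw [hμ, PMF.map_apply, ENNReal.tsum_eq_zero]
    intro r
    rw [if_neg]
    rintro rfl
    exact hB (card_top r hk)
  have hswap : ∀ g h : Fin m, expect μ (fun B => if g ∈ B then 1 else 0) =
      expect μ fun B => if h ∈ B then 1 else 0 := by
    intro g h
    simp only [expect]
    refine Fintype.sum_equiv (Equiv.finsetCongr (Equiv.swap g h)) _ _ fun B => ?_
    have hcard : (Equiv.finsetCongr (Equiv.swap g h) B).card = B.card := by
      simp
    have hmem : h ∈ Equiv.finsetCongr (Equiv.swap g h) B ↔ g ∈ B := by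
      rw [Equiv.finsetCongr_apply, Finset.mem_map_equiv]
      simp
    simp only [hmem]
    congr 2
    by_cases hB : B.card = k
    · rw [hμ, ← topProb_eq, ← topProb_eq]
      exact hF _ _ hB (hcard.trans hB)
    · rw [hzero _ hB, hzero _ (hcard ▸ hB)]
  have hsum : ∑ g : Fin m, expect (rankingLaw F) (fun r => if g ∈ r.top k then 1 else 0) = k := by
    rw [← expect_sum]
    simp only [Finset.sum_boole, Finset.filter_mem_eq_inter, Finset.univ_inter, card_top _ hk,
      expect_const]
  have hm : (m : ℝ) ≠ 0 := by
    have := g.pos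
    positivity
  have hall : ∀ h : Fin m, expect (rankingLaw F) (fun r => if h ∈ r.top k then 1 else 0) =
      expect (rankingLaw F) (fun r => if g ∈ r.top k then 1 else 0) := fun h => by
    rw [hmap, hmap, hswap]
  rw [Finset.sum_congr rfl fun h _ => hall h, Finset.sum_const, Finset.card_univ,
    Fintype.card_fin, nsmul_eq_mul] at hsum
  rw [eq_div_iff hm, mul_comm]
  exact hsum

theorem sum_le_sum_top (v : Valuation m) {r : Ranking m} (hr : r ∈ consistent v) {k : ℕ}
    (hk : k ≤ m) (B : Finset (Fin m)) (hB : B.card ≤ k) :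
    ∑ g ∈ B, (v g : ℝ≥0∞) ≤ ∑ g ∈ r.top k, (v g : ℝ≥0∞) := by
  classical
  have hr' : ∀ g h, v h < v g → r g < r h := by simpa [consistent] using hr
  have hle : ∀ g ∉ r.top k, ∀ h ∈ r.top k, v g ≤ v h := by
    intro g hg h hh
    simp only [Ranking.top, Finset.mem_filter, Finset.mem_univ, true_and, not_lt] at hg hh
    by_contra hlt
    have := hr' g h (not_le.1 hlt)
    rw [Fin.lt_def] at this
    omega
  have hcard : (B \ r.top k).card ≤ (r.top k \ B).card := by
    have h1 := Finset.card_sdiff_add_card_inter B (r.top k)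
    have h2 := Finset.card_sdiff_add_card_inter (r.top k) B
    rw [Finset.inter_comm, card_top r hk] at h2
    omega
  rw [← Finset.sum_inter_add_sum_sdiff B (r.top k), ← Finset.sum_inter_add_sum_sdiff (r.top k) B,
    Finset.inter_comm (r.top k) B]
  gcongr _ + ?_
  rcases (r.top k \ B).eq_empty_or_nonempty with he | hne
  · rw [he, Finset.card_empty, Nat.le_zero, Finset.card_eq_zero] at hcard
    simp [hcard]
  · obtain ⟨h, hh, hmin⟩ := Finset.exists_min_image _ (fun g => v g) hne
    calc ∑ g ∈ B \ r.top k, (v g : ℝ≥0∞) ≤ (B \ r.top k).card • (v h : ℝ≥0∞) :=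
          Finset.sum_le_card_nsmul _ _ _ fun g hg => ENNReal.coe_le_coe.2
            (hle g (Finset.mem_sdiff.1 hg).2 h (Finset.mem_sdiff.1 hh).1)
      _ ≤ (r.top k \ B).card • (v h : ℝ≥0∞) := nsmul_le_nsmul_left zero_le hcard
      _ ≤ _ := Finset.card_nsmul_le_sum _ _ _ fun g hg => ENNReal.coe_le_coe.2 (hmin g hg)

/-- The mean value of the `k` favorite items, over the resolution of ties. -/
def favoriteValue (k : ℕ) (v : Valuation m) : ℝ≥0∞ :=
  ∑ r, randomRanking v r * ∑ g ∈ r.top k, (v g : ℝ≥0∞)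

theorem sum_randomRanking (v : Valuation m) : ∑ r, randomRanking v r = 1 := by
  rw [← tsum_fintype (L := .unconditional _), PMF.tsum_coe]

theorem le_favoriteValue (v : Valuation m) {c : ℝ≥0∞} {k : ℕ}
    (h : ∀ r ∈ consistent v, c ≤ ∑ g ∈ r.top k, (v g : ℝ≥0∞)) : c ≤ favoriteValue k v := by
  calc c = ∑ r, randomRanking v r * c := by rw [← Finset.sum_mul, sum_randomRanking, one_mul]
    _ ≤ _ := by
      refine Finset.sum_le_sum fun r _ => ?_
      by_cases hr : r ∈ consistent v
      · gcongr
        exact h r hr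
      · rw [randomRanking_apply, if_neg hr]
        simp

theorem favoriteValue_le (v : Valuation m) {c : ℝ≥0∞} {k : ℕ}
    (h : ∀ r : Ranking m, ∑ g ∈ r.top k, (v g : ℝ≥0∞) ≤ c) : favoriteValue k v ≤ c := by
  calc _ ≤ ∑ r, randomRanking v r * c := by
        refine Finset.sum_le_sum fun r _ => ?_
        gcongr
        exact h r
    _ = c := by rw [← Finset.sum_mul, sum_randomRanking, one_mul]

theorem measurable_favoriteValue (k : ℕ) :
    Measurable fun v : Valuation m => favoriteValue k v :=
  Finset.measurable_sum _ fun r _ => (measurable_randomRanking r).mul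
    (Finset.measurable_sum _ fun g _ => (measurable_pi_apply g).coe_nnreal_ennreal)

theorem lintegral_favoriteValue (F : ProbabilityMeasure (Valuation m)) (k : ℕ) :
    ∫⁻ v, favoriteValue k v ∂(F : Measure (Valuation m)) =
      ∑ r : Ranking m, ∑ g ∈ r.top k, rankedValue F r g := by
  simp only [favoriteValue, Finset.mul_sum]
  have hmeas : ∀ (r : Ranking m) (g : Fin m), Measurable
      fun v : Valuation m => randomRanking v r * (v g : ℝ≥0∞) := fun r g =>
    (measurable_randomRanking r).mul (measurable_pi_apply g).coe_nnreal_ennreal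
  rw [lintegral_finsetSum _ fun r _ => Finset.measurable_sum _ fun g _ => hmeas r g]
  refine Finset.sum_congr rfl fun r _ => ?_
  rw [lintegral_finsetSum _ fun g _ => hmeas r g]
  rfl

theorem Quota.b_le_m (Q : Quota) (i : Fin Q.n) : Q.b i ≤ Q.m :=
  Finset.single_le_sum (f := Q.b) (fun _ _ => Nat.zero_le _) (Finset.mem_univ i)

/-- Relaxation: each agent takes her best bundle, regardless of conflicts. -/
theorem optWelfare_le {Q : Quota} (V : ValuationProfile Q) :
    optWelfare V ≤ ∑ i, favoriteValue (Q.b i) (V i) := by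
  refine iSup₂_le fun a ha => Finset.sum_le_sum fun i _ => ?_
  exact le_favoriteValue _ fun r hr => sum_le_sum_top _ hr (Q.b_le_m i) _ (ha i)

theorem expectedOpt_le {Q : Quota} (F : Fin Q.n → ProbabilityMeasure (Valuation Q.m)) :
    expectedOpt F ≤ ∑ i, ∑ r : Ranking Q.m, ∑ g ∈ r.top (Q.b i), rankedValue (F i) r g := by
  calc expectedOpt F ≤ ∫⁻ V : ValuationProfile Q, ∑ i, favoriteValue (Q.b i) (V i)
        ∂(Measure.pi fun i => (F i : Measure (Valuation Q.m))) :=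
        lintegral_mono fun V => optWelfare_le V
    _ = _ := by
      have hmeas : ∀ i, Measurable fun V : ValuationProfile Q => favoriteValue (Q.b i) (V i) :=
        fun i => (measurable_favoriteValue (Q.b i)).comp (measurable_pi_apply i)
      rw [lintegral_finsetSum _ fun i _ => hmeas i]
      refine Finset.sum_congr rfl fun i _ => ?_
      rw [← lintegral_favoriteValue]
      exact (measurePreserving_eval (fun i => (F i : Measure (Valuation Q.m))) i).lintegral_comp
        (measurable_favoriteValue (Q.b i))

theorem ofReal_expect {α : Type} [Fintype α] (p : PMF α) {f : α → ℝ} (hf : ∀ a, 0 ≤ f a) :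
    ENNReal.ofReal (expect p f) = ∑ a, p a * ENNReal.ofReal (f a) := by
  rw [expect, ENNReal.ofReal_sum_of_nonneg fun a _ => mul_nonneg ENNReal.toReal_nonneg (hf a)]
  refine Finset.sum_congr rfl fun a _ => ?_
  rw [ENNReal.ofReal_mul ENNReal.toReal_nonneg, ENNReal.ofReal_toReal (p.apply_ne_top a)]

/-- By independence, conditioning on the ranking of `i` amounts to replacing her law by a point
mass. The weight `w` need not be a probability; it will be `rankedValue`. -/
theorem sum_condition {ι α : Type} [Fintype ι] [DecidableEq ι] [Fintype α] (p : ι → PMF α)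
    (i : ι) (w : α → ℝ≥0∞) {f : (ι → α) → ℝ} (hf : ∀ R, 0 ≤ f R) :
    ∑ R : ι → α, (∏ j ∈ Finset.univ.erase i, p j (R j)) * w (R i) * ENNReal.ofReal (f R) =
      ∑ r, w r * ENNReal.ofReal (expect (independent (Function.update p i (PMF.pure r))) f) := by
  classical
  have h1 : ∀ (r : α) (R : ι → α), independent (Function.update p i (PMF.pure r)) R =
      (if R i = r then 1 else 0) * ∏ j ∈ Finset.univ.erase i, p j (R j) := by
    intro r R
    rw [independent_apply, ← Finset.mul_prod_erase _ _ (Finset.mem_univ i)]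
    congr 1
    · simp [PMF.pure_apply]
    · refine Finset.prod_congr rfl fun j hj => ?_
      rw [Function.update_of_ne (Finset.mem_erase.1 hj).1]
  simp only [ofReal_expect _ hf, h1, Finset.mul_sum]
  rw [Finset.sum_comm]
  refine Finset.sum_congr rfl fun R _ => ?_
  rw [Finset.sum_eq_single (R i)]
  · simp only [if_true]
    ring
  · intro r _ hr
    simp [hr.symm]
  · simp

end Favorites

/-! ### The distortion of RSBS -/

section UpperBound

variable {Q : Quota} {sel : (Q : Quota) → Fin Q.n}

theorem Quota.m_pos (Q : Quota) : 0 < Q.m :=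
  lt_of_lt_of_le (Q.b_pos ⟨0, Q.n_pos⟩) (Q.b_le_m _)

theorem Quota.m_pos_real (Q : Quota) : (0 : ℝ) < Q.m := Nat.cast_pos.2 Q.m_pos

theorem Quota.sum_div (Q : Quota) : ∑ i, (Q.b i : ℝ) / Q.m = 1 := by
  rw [← Finset.sum_div, ← Nat.cast_sum]
  exact div_self Q.m_pos_real.ne'

theorem Quota.sum_erase_div (Q : Quota) {s : Fin Q.n} (hs : Q.b s = Q.bmax) :
    ∑ i ∈ Finset.univ.erase s, (Q.b i : ℝ) / Q.m = 1 - Q.ratio := by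
  have := Finset.add_sum_erase Finset.univ (fun i => (Q.b i : ℝ) / Q.m) (Finset.mem_univ s)
  rw [Q.sum_div, hs] at this
  rw [← this, Quota.ratio]
  ring

/-- Burning is calibrated so that the surviving probability is the same for all agents. A vanishing
numerator or denominator would make the quotient 0 and the burning probability 1, so `h` yields the
non-vanishing. -/
theorem one_sub_burningProb_mul {s i : Fin Q.n} (h : burningProb Q s i < 1) :
    1 - Real.exp (-1 + Q.ratio) ≠ 0 ∧ 1 - Q.ratio ≠ 0 ∧
    (1 - burningProb Q s i) * (survivalProb Q i *
      ∫ y in (0 : ℝ)..1, ∏ j ∈ Finset.univ \ {i, s},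
        (1 - survivalProb Q j * (Q.b j : ℝ) / (Q.m : ℝ) * y)) =
      (1 - Real.exp (-1 + Q.ratio)) / (1 - Q.ratio) := by
  have hdef : 1 - burningProb Q s i = (1 - Real.exp (-1 + Q.ratio)) /
      ((1 - Q.ratio) * survivalProb Q i *
        ∫ y in (0 : ℝ)..1, ∏ j ∈ Finset.univ \ {i, s},
          (1 - survivalProb Q j * (Q.b j : ℝ) / (Q.m : ℝ) * y)) := by
    rw [burningProb]
    ring
  have hne : 1 - burningProb Q s i ≠ 0 := by linarith
  rw [hdef] at hne ⊢
  obtain ⟨h1, h2⟩ := div_ne_zero_iff.1 hne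
  obtain ⟨h2, h3⟩ := mul_ne_zero_iff.1 h2
  obtain ⟨h2, h4⟩ := mul_ne_zero_iff.1 h2
  refine ⟨h1, h2, ?_⟩
  generalize (∫ y in (0 : ℝ)..1, ∏ j ∈ Finset.univ \ {i, s},
    (1 - survivalProb Q j * (Q.b j : ℝ) / (Q.m : ℝ) * y)) = I at *
  field_simp

theorem exp_ne_one_of_ratio_ne_one (h : 1 - Q.ratio ≠ 0) :
    1 - Real.exp (-1 + Q.ratio) ≠ 0 := by
  intro h0
  have h1 : Real.exp (-1 + Q.ratio) = 1 := by linarith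
  rw [Real.exp_eq_one_iff] at h1
  exact h (by linarith)

theorem le_expect_assignProb (hs : Q.b (sel Q) = Q.bmax)
    (hp : ∀ i, survivalProb Q i ∈ Set.Ioc (0 : ℝ) 1)
    (hβ : ∀ i, i ≠ sel Q → burningProb Q (sel Q) i ∈ Set.Ico (0 : ℝ) 1)
    (hσ : stealingProb Q ∈ Set.Ico (0 : ℝ) 1)
    (P : Fin Q.n → PMF (Ranking Q.m))
    (hP : ∀ j g, expect (P j) (fun r => if g ∈ r.top (Q.b j) then 1 else 0) =
      (Q.b j : ℝ) / Q.m)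
    (i : Fin Q.n) (r : Ranking Q.m) (g : Fin Q.m) (hg : g ∈ r.top (Q.b i)) :
    1 - (1 - Q.ratio) * Real.exp (-1 + Q.ratio) ≤
      expect (independent (Function.update P i (PMF.pure r)))
        fun R => assignProb (RSBS sel) R i g := by
  have hp' : ∀ j, survivalProb Q j ∈ Set.Icc (0 : ℝ) 1 := fun j => ⟨(hp j).1.le, (hp j).2⟩
  have hβ' : ∀ j, j ≠ sel Q → burningProb Q (sel Q) j ∈ Set.Icc (0 : ℝ) 1 :=
    fun j hj => ⟨(hβ j hj).1, (hβ j hj).2.le⟩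
  have hσ' : stealingProb Q ∈ Set.Icc (0 : ℝ) 1 := ⟨hσ.1, hσ.2.le⟩
  set A := 1 - Real.exp (-1 + Q.ratio) with hA
  have hE : Real.exp (-1 + Q.ratio) = 1 - A := by rw [hA]; ring
  by_cases his : i = sel Q
  · subst his
    set P' := Function.update P (sel Q) (PMF.pure r) with hP'
    have hx : ∀ j, j ≠ sel Q → expect (P' j) (fun r => if g ∈ r.top (Q.b j) then 1 else 0) =
        (Q.b j : ℝ) / Q.m := by
      intro j hj
      rw [hP', Function.update_of_ne hj, hP]
    -- After burning, `j` holds the item with probability c_j A/(1-y); summed over j ≠ s this is A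
    -- when y ≠ 1.
    have hterm : ∀ j ∈ Finset.univ.erase (sel Q),
        expect (independent P') (fun R => phaseOneProb R (sel Q) g j) *
          (1 - burningProb Q (sel Q) j) = (Q.b j : ℝ) / Q.m * (A / (1 - Q.ratio)) := by
      intro j hj
      have hj := (Finset.mem_erase.1 hj).1
      have h := expect_phaseOneProb hp' P' hj g (fun j => (Q.b j : ℝ) / Q.m) hx fun _ => 1
      simp only [mul_one, expect_const] at h
      have h2 := (one_sub_burningProb_mul (hβ j hj).2).2.2
      simp only [mul_div_assoc] at h2
      rw [h, ← hA] at *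
      rw [← h2]
      ring
    have hbound : expect (independent P') (fun R => 1 - (1 - stealingProb Q) *
        ∑ j ∈ Finset.univ.erase (sel Q),
          phaseOneProb R (sel Q) g j * (1 - burningProb Q (sel Q) j)) ≤
        expect (independent P') fun R => assignProb (RSBS sel) R (sel Q) g := by
      refine Finset.sum_le_sum fun R _ => ?_
      by_cases hR : R (sel Q) = r
      · exact mul_le_mul_of_nonneg_left
          (le_expect_run_eq_sel R g (hR ▸ hg) hβ' hσ') ENNReal.toReal_nonneg
      · have : independent P' R = 0 := by
          rw [independent_apply]
          refine Finset.prod_eq_zero (Finset.mem_univ (sel Q)) ?_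
          rw [hP', Function.update_self, PMF.pure_apply, if_neg hR]
        simp [this]
    refine le_trans (le_of_eq ?_) hbound
    rw [expect_sub, expect_const, expect_mul_left, expect_sum]
    simp only [expect_mul_right]
    rw [Finset.sum_congr rfl hterm, ← Finset.sum_mul, Q.sum_erase_div hs]
    -- Ratio 1 means a single agent: nothing is lost to others, and the value of `stealingProb` is
    -- irrelevant.
    by_cases hy : 1 - Q.ratio = 0
    · rw [hy]
      ring
    · have hA0 : A ≠ 0 := exp_ne_one_of_ratio_ne_one hy
      rw [mul_div_cancel₀ _ hy, stealingProb, ← hA, hE]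
      field_simp
      ring
  · have hx : ∀ j, j ≠ sel Q → expect (Function.update P i (PMF.pure r) j)
        (fun r => if g ∈ r.top (Q.b j) then 1 else 0) =
        if j = i then 1 else (Q.b j : ℝ) / Q.m := by
      intro j _
      by_cases hj : j = i
      · subst hj
        rw [Function.update_self, expect_pure, if_pos hg, if_pos rfl]
      · rw [Function.update_of_ne hj, hP, if_neg hj]
    have h := expect_phaseOneProb hp' (Function.update P i (PMF.pure r)) his g
      (fun j => if j = i then 1 else (Q.b j : ℝ) / Q.m) hx fun r =>
        (1 - burningProb Q (sel Q) i) *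
          (1 - stealingProb Q * if g ∈ r.top (Q.b (sel Q)) then 1 else 0)
    have hrun : ∀ R, assignProb (RSBS sel) R i g = _ := fun R =>
      expect_run_eq_some R g his (hβ' i his) hσ'
    simp only [hrun]
    rw [h, Function.update_of_ne (Ne.symm his), expect_mul_left, expect_sub, expect_const,
      expect_mul_left, hP, hs]
    obtain ⟨hA0, hy, h2⟩ := one_sub_burningProb_mul (hβ i his).2
    have hint : (∫ y in (0 : ℝ)..1, ∏ j ∈ Finset.univ \ {i, sel Q},
        (1 - survivalProb Q j * (if j = i then 1 else (Q.b j : ℝ) / Q.m) * y)) =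
        ∫ y in (0 : ℝ)..1, ∏ j ∈ Finset.univ \ {i, sel Q},
          (1 - survivalProb Q j * (Q.b j : ℝ) / (Q.m : ℝ) * y) := by
      congr 1
      funext y
      refine Finset.prod_congr rfl fun j hj => ?_
      simp only [Finset.mem_sdiff, Finset.mem_univ, true_and, Finset.mem_insert, not_or] at hj
      rw [if_neg hj.1, mul_div_assoc]
    rw [hint, if_pos rfl, mul_one]
    refine le_of_eq ?_
    rw [← hA] at hA0 h2
    -- The ranking of `s` is independent of that of `i`, so the item is stolen with probability σy.
    -- The choice of σ turns the factor A/(1-y) into exactly D.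
    have hσ2 : 1 - stealingProb Q * ((Q.bmax : ℝ) / Q.m) =
        (1 - Q.ratio) * (1 - (1 - Q.ratio) * Real.exp (-1 + Q.ratio)) / A := by
      change 1 - stealingProb Q * Q.ratio = _
      rw [stealingProb, ← hA, hE]
      field_simp
      ring
    rw [hσ2]
    set I := ∫ y in (0 : ℝ)..1, ∏ j ∈ Finset.univ \ {i, sel Q},
          (1 - survivalProb Q j * (Q.b j : ℝ) / (Q.m : ℝ) * y)
    calc _ = ((1 - burningProb Q (sel Q) i) * (survivalProb Q i * I)) *
          ((1 - Q.ratio) * (1 - (1 - Q.ratio) * Real.exp (-1 + Q.ratio)) / A) := by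
          rw [h2]
          field_simp
      _ = _ := by ring

theorem distortionOn_RSBS_le (hs : Q.b (sel Q) = Q.bmax)
    (hp : ∀ i, survivalProb Q i ∈ Set.Ioc (0 : ℝ) 1)
    (hβ : ∀ i, i ≠ sel Q → burningProb Q (sel Q) i ∈ Set.Ico (0 : ℝ) 1)
    (hσ : stealingProb Q ∈ Set.Ico (0 : ℝ) 1)
    (hD : 0 < 1 - (1 - Q.ratio) * Real.exp (-1 + Q.ratio)) :
    distortionOn (RSBS sel) Q ≤
      ENNReal.ofReal ((1 - (1 - Q.ratio) * Real.exp (-1 + Q.ratio))⁻¹) := by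
  classical
  set D := 1 - (1 - Q.ratio) * Real.exp (-1 + Q.ratio) with hDdef
  refine iSup₂_le fun F hF => ENNReal.div_le_of_le_mul ?_
  have hwel : ENNReal.ofReal D *
      (∑ i, ∑ r : Ranking Q.m, ∑ g ∈ r.top (Q.b i), rankedValue (F i) r g) ≤
      expectedWelfare (RSBS sel) F := by
    rw [expectedWelfare_eq, Finset.mul_sum]
    refine Finset.sum_le_sum fun i _ => ?_
    have hcond : ∀ g : Fin Q.m, ∑ R : PrefProfile Q,
        (∏ j ∈ Finset.univ.erase i, rankingLaw (F j) (R j)) * rankedValue (F i) (R i) g *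
        ENNReal.ofReal (assignProb (RSBS sel) R i g) = _ := fun g =>
      sum_condition (fun j => rankingLaw (F j)) i (fun r => rankedValue (F i) r g)
        fun R => assignProb_nonneg (RSBS sel) R i g
    simp only [hcond]
    rw [Finset.sum_comm, Finset.mul_sum]
    refine Finset.sum_le_sum fun r _ => ?_
    rw [Finset.mul_sum]
    -- Only favorite items are counted; the remaining welfare is non-negative.
    refine le_trans (Finset.sum_le_sum fun g hg => ?_)
      (Finset.sum_le_univ_sum_of_nonneg fun g => zero_le)
    rw [mul_comm]
    gcongr
    exact le_expect_assignProb hs hp hβ hσ (fun j => rankingLaw (F j))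
      (fun j g => expect_mem_top (Q.b_le_m j) (hF j) g) i r g hg
  calc expectedOpt F ≤ _ := expectedOpt_le F
    _ = ENNReal.ofReal D⁻¹ * (ENNReal.ofReal D *
        (∑ i, ∑ r : Ranking Q.m, ∑ g ∈ r.top (Q.b i), rankedValue (F i) r g)) := by
      rw [← mul_assoc, ← ENNReal.ofReal_mul (inv_nonneg.2 hD.le), inv_mul_cancel₀ hD.ne',
        ENNReal.ofReal_one, one_mul]
    _ ≤ _ := by gcongr

end UpperBound

/-! ### Lower bound on the distortion of all mechanisms -/

section LowerBound

variable {m : ℕ}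

theorem mem_top {r : Ranking m} {k : ℕ} {g : Fin m} : g ∈ r.top k ↔ (r g : ℕ) < k := by
  simp [Ranking.top]

/-- The valuation vector that has value `x` for the `k` top items of a ranking, and `0` for all
other items. -/
def topValuation (k : ℕ) (x : ℝ≥0) (r : Ranking m) : Valuation m :=
  fun g => if g ∈ r.top k then x else 0

theorem consistent_topValuation {k : ℕ} (hk : k ≤ m) {x : ℝ≥0} (hx : 0 < x) (r' r : Ranking m) :
    r ∈ consistent (topValuation k x r') ↔ r.top k = r'.top k := by
  classical
  have hlt : ∀ g h, topValuation k x r' h < topValuation k x r' g ↔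
      g ∈ r'.top k ∧ h ∉ r'.top k := by
    intro g h
    unfold topValuation
    split_ifs with h1 h2 h2 <;> simp [h1, h2, hx]
  have hcons : r ∈ consistent (topValuation k x r') ↔
      ∀ g h, g ∈ r'.top k ∧ h ∉ r'.top k → r g < r h := by
    simp [consistent, hlt]
  rw [hcons]
  constructor
  · intro h
    refine (Finset.eq_of_subset_of_card_le (fun g hg => ?_) ?_).symm
    · by_contra hg'
      have hss : ¬ r.top k ⊆ r'.top k := by
        intro hss
        have := Finset.eq_of_subset_of_card_le hss (by rw [card_top r hk, card_top r' hk])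
        exact hg' (this ▸ hg)
      obtain ⟨g', hg1, hg2⟩ := Finset.not_subset.1 hss
      have h1 := h g g' ⟨hg, hg2⟩
      rw [Fin.lt_def] at h1
      rw [mem_top] at hg1 hg'
      omega
    · rw [card_top r hk, card_top r' hk]
  · rintro h g g' ⟨hg, hg'⟩
    rw [← h, mem_top] at hg hg'
    rw [Fin.lt_def]
    omega

/-- Re-ranking after only the top set is remembered is uniform on the rankings with that top set.
This kernel is symmetric, hence doubly stochastic: summing over the source `r'` acts like summing
over the target. -/
theorem sum_randomRanking_topValuation {k : ℕ} (hk : k ≤ m) {x : ℝ≥0} (hx : 0 < x)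
    (r : Ranking m) (φ : Finset (Fin m) → ℝ≥0∞) :
    ∑ r', randomRanking (topValuation k x r') r * φ (r'.top k) = φ (r.top k) := by
  classical
  have hterm : ∀ r' : Ranking m, randomRanking (topValuation k x r') r * φ (r'.top k) =
      if r' ∈ consistent (topValuation k x r) then
        ((consistent (topValuation k x r)).card : ℝ≥0∞)⁻¹ * φ (r.top k) else 0 := by
    intro r'
    rw [randomRanking_apply]
    by_cases h : r.top k = r'.top k
    · have hc : consistent (topValuation k x r') = consistent (topValuation k x r) := by
        ext r''
        rw [consistent_topValuation hk hx, consistent_topValuation hk hx, h]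
      rw [if_pos ((consistent_topValuation hk hx r' r).2 h),
        if_pos ((consistent_topValuation hk hx r r').2 h.symm), hc, h]
    · rw [if_neg fun h' => h ((consistent_topValuation hk hx r' r).1 h'),
        if_neg fun h' => h ((consistent_topValuation hk hx r r').1 h').symm, zero_mul]
  simp only [hterm, Finset.sum_ite_mem, Finset.univ_inter, Finset.sum_const, nsmul_eq_mul]
  rw [← mul_assoc, ENNReal.mul_inv_cancel, one_mul]
  · exact_mod_cast (Finset.card_pos.2 (consistent_nonempty _)).ne'
  · exact ENNReal.natCast_ne_top _

/-- The probability of a single ranking under the uniform law. -/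
def uniformWeight (m : ℕ) : ℝ≥0∞ := (Fintype.card (Ranking m) : ℝ≥0∞)⁻¹

theorem sum_uniformWeight (c : ℝ≥0∞) : ∑ _r : Ranking m, uniformWeight m * c = c := by
  rw [Finset.sum_const, Finset.card_univ, nsmul_eq_mul, uniformWeight, ← mul_assoc,
    ENNReal.mul_inv_cancel, one_mul]
  · exact_mod_cast Fintype.card_ne_zero
  · exact ENNReal.natCast_ne_top _

/-- With probability `ε` the agent has value `1 / ε` for a uniformly random bundle of `k` items,
and otherwise all her values are `0`. -/
def spikeMeasure (m k : ℕ) (ε : ℝ≥0) : Measure (Valuation m) :=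
  ((1 - ε : ℝ≥0) : ℝ≥0∞) • Measure.dirac 0 +
    (ε : ℝ≥0∞) • ∑ r : Ranking m, uniformWeight m • Measure.dirac (topValuation k ε⁻¹ r)

theorem lintegral_spikeMeasure (k : ℕ) (ε : ℝ≥0) {f : Valuation m → ℝ≥0∞} (hf : Measurable f) :
    ∫⁻ v, f v ∂(spikeMeasure m k ε) = ((1 - ε : ℝ≥0) : ℝ≥0∞) * f 0 +
      ε * ∑ r : Ranking m, uniformWeight m * f (topValuation k ε⁻¹ r) := by
  simp only [spikeMeasure, lintegral_add_measure, lintegral_smul_measure,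
    lintegral_finsetSum_measure, lintegral_dirac' _ hf, smul_eq_mul]

theorem one_sub_add {ε : ℝ≥0} (hε : ε ≤ 1) : ((1 - ε : ℝ≥0) : ℝ≥0∞) + ε = 1 := by
  rw [← ENNReal.coe_add, tsub_add_cancel_of_le hε, ENNReal.coe_one]

theorem isProbabilityMeasure_spikeMeasure (k : ℕ) {ε : ℝ≥0} (hε : ε ≤ 1) :
    IsProbabilityMeasure (spikeMeasure m k ε) := by
  refine ⟨?_⟩
  have := lintegral_spikeMeasure (m := m) k ε (f := fun _ => 1) measurable_const
  rw [lintegral_one, sum_uniformWeight, mul_one, mul_one, one_sub_add hε] at this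
  exact this

/-- The spike distribution as a probability measure. -/
def spike (m k : ℕ) {ε : ℝ≥0} (hε : ε ≤ 1) : ProbabilityMeasure (Valuation m) :=
  ⟨spikeMeasure m k ε, isProbabilityMeasure_spikeMeasure k hε⟩

theorem randomRanking_zero (r : Ranking m) : randomRanking (0 : Valuation m) r =
    uniformWeight m := by
  have h : consistent (0 : Valuation m) = Finset.univ := by
    ext r
    simp [consistent]
  rw [randomRanking_apply, h, if_pos (Finset.mem_univ r), Finset.card_univ, uniformWeight]

theorem rankingLaw_spike {k : ℕ} (hk : k ≤ m) {ε : ℝ≥0} (hε0 : 0 < ε) (hε : ε ≤ 1)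
    (r : Ranking m) : rankingLaw (spike m k hε) r = uniformWeight m := by
  have h := sum_randomRanking_topValuation hk (inv_pos.2 hε0) r fun _ => 1
  simp only [mul_one] at h
  change ∫⁻ v, randomRanking v r ∂(spikeMeasure m k ε) = _
  rw [lintegral_spikeMeasure k ε (measurable_randomRanking r), ← Finset.mul_sum, h,
    randomRanking_zero, mul_one, ← add_mul, one_sub_add hε, one_mul]

/-- The probability ε and the value 1/ε cancel. Thus the welfare of a mechanism does not depend on
ε, while OPT does. -/
theorem rankedValue_spike {k : ℕ} (hk : k ≤ m) {ε : ℝ≥0} (hε0 : 0 < ε) (hε : ε ≤ 1)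
    (r : Ranking m) (g : Fin m) :
    rankedValue (spike m k hε) r g = uniformWeight m * if g ∈ r.top k then 1 else 0 := by
  have h := sum_randomRanking_topValuation hk (inv_pos.2 hε0) r
    fun B => if g ∈ B then ((ε⁻¹ : ℝ≥0) : ℝ≥0∞) else 0
  have hval : ∀ r' : Ranking m, (topValuation k ε⁻¹ r' g : ℝ≥0∞) =
      if g ∈ r'.top k then ((ε⁻¹ : ℝ≥0) : ℝ≥0∞) else 0 := by
    intro r'
    unfold topValuation
    split_ifs <;> simp
  change ∫⁻ v, randomRanking v r * (v g : ℝ≥0∞) ∂(spikeMeasure m k ε) = _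
  have hmeas : Measurable fun v : Valuation m => randomRanking v r * (v g : ℝ≥0∞) :=
    (measurable_randomRanking r).mul (measurable_pi_apply g).coe_nnreal_ennreal
  rw [lintegral_spikeMeasure k ε hmeas, ← Finset.mul_sum]
  simp only [hval, h]
  simp only [Pi.zero_apply, ENNReal.coe_zero, mul_zero, zero_add]
  split_ifs
  · rw [mul_left_comm, ← ENNReal.coe_mul, mul_inv_cancel₀ hε0.ne', ENNReal.coe_one]
  · simp

theorem unbiasedFavorites_spike {k : ℕ} (hk : k ≤ m) {ε : ℝ≥0} (hε0 : 0 < ε) (hε : ε ≤ 1) :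
    UnbiasedFavorites (spike m k hε : Measure (Valuation m)) k := by
  classical
  intro B C hB hC
  rw [topProb_eq, topProb_eq, PMF.map_apply, PMF.map_apply, tsum_fintype, tsum_fintype]
  simp only [rankingLaw_spike hk hε0 hε]
  set e : Equiv.Perm (Fin m) := (Finset.equivOfCardEq (hB.trans hC.symm)).extendSubtype with he
  have hmem : ∀ g, e g ∈ C ↔ g ∈ B := by
    intro g
    constructor
    · intro h
      by_contra h'
      exact Equiv.extendSubtype_not_mem _ g h' h
    · intro h
      exact Equiv.extendSubtype_mem _ g h
  -- Relabeling the items by `e`, which carries `B` to `C`, preserves the uniform law of the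
  -- ranking.
  refine Fintype.sum_equiv (Equiv.mulRight e⁻¹) _ _ fun r => ?_
  have htop : ∀ g, e g ∈ Ranking.top (Equiv.mulRight e⁻¹ r) k ↔ g ∈ Ranking.top r k := by
    intro g
    rw [mem_top, mem_top, Equiv.coe_mulRight, Equiv.Perm.mul_apply, Equiv.Perm.inv_def,
      Equiv.symm_apply_apply]
  refine if_congr ?_ rfl rfl
  rw [Finset.ext_iff, Finset.ext_iff]
  constructor
  · intro h g
    obtain ⟨g, rfl⟩ := e.surjective g
    rw [hmem, htop, h]
  · intro h g
    rw [← hmem, ← htop, h]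

theorem favoriteValue_le_optWelfare {Q : Quota} (V : ValuationProfile Q) (i : Fin Q.n) :
    favoriteValue (Q.b i) (V i) ≤ optWelfare V := by
  classical
  refine favoriteValue_le _ fun r => ?_
  set a : Assignment Q := fun g => if g ∈ r.top (Q.b i) then some i else none with ha
  have hb : ∀ j, bundle a j = if j = i then r.top (Q.b i) else ∅ := by
    intro j
    ext g
    simp only [bundle, ha, Finset.mem_filter, Finset.mem_univ, true_and]
    by_cases hj : j = i
    · subst hj
      by_cases hg : g ∈ r.top (Q.b j) <;> simp [hg]
    · by_cases hg : g ∈ r.top (Q.b i) <;> simp [hg, hj, Ne.symm hj]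
  have hmatch : IsMatching a := by
    intro j
    rw [hb]
    split_ifs with hj
    · rw [hj]
      exact card_top_le _ _
    · simp
  refine le_trans ?_ (le_iSup₂_of_le a hmatch le_rfl)
  have hle := Finset.single_le_sum (s := Finset.univ)
    (f := fun j => ∑ g ∈ bundle a j, (V j g : ℝ≥0∞)) (fun _ _ => zero_le) (Finset.mem_univ i)
  simp only [hb, if_true] at hle
  simpa only [welfare, hb] using hle

/-- The i-th summand vanishes unless all other agents have zero valuations, so at most one summand
is non-zero, and that agent alone can be served in full. The product form lets the integral factor
over agents. -/
theorem sum_favoriteValue_le_optWelfare {Q : Quota} (V : ValuationProfile Q) :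
    ∑ i, ∏ j, (if j = i then favoriteValue (Q.b j) (V j) else
      ({0} : Set (Valuation Q.m)).indicator 1 (V j)) ≤ optWelfare V := by
  classical
  by_cases h : ∃ i, V i ≠ 0
  · obtain ⟨i, hi⟩ := h
    rw [Finset.sum_eq_single i]
    · rw [← Finset.mul_prod_erase _ _ (Finset.mem_univ i), if_pos rfl]
      refine le_trans (mul_le_of_le_one_right' (Finset.prod_le_one' fun j hj => ?_))
        (favoriteValue_le_optWelfare V i)
      rw [if_neg (Finset.mem_erase.1 hj).1, Set.indicator_apply]
      split_ifs <;> simp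
    · intro k _ hk
      refine Finset.prod_eq_zero (Finset.mem_univ i) ?_
      rw [if_neg hk.symm, Set.indicator_of_notMem (by simpa using hi)]
    · simp
  · push Not at h
    have h0 : ∀ i, ∏ j, (if j = i then favoriteValue (Q.b j) (V j) else
      ({0} : Set (Valuation Q.m)).indicator 1 (V j)) = 0 := by
      intro i
      refine Finset.prod_eq_zero (Finset.mem_univ i) ?_
      simp [favoriteValue, h]
    rw [Finset.sum_eq_zero fun i _ => h0 i]
    exact zero_le

theorem lintegral_favoriteValue_spike {k : ℕ} (hk : k ≤ m) {ε : ℝ≥0} (hε0 : 0 < ε)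
    (hε : ε ≤ 1) : ∫⁻ v, favoriteValue k v ∂(spike m k hε : Measure (Valuation m)) = k := by
  rw [lintegral_favoriteValue]
  have h : ∀ r : Ranking m, ∑ g ∈ r.top k, rankedValue (spike m k hε) r g =
      uniformWeight m * k := by
    intro r
    have h1 : ∀ g ∈ r.top k, rankedValue (spike m k hε) r g = uniformWeight m := by
      intro g hg
      rw [rankedValue_spike hk hε0 hε, if_pos hg, mul_one]
    rw [Finset.sum_congr rfl h1, Finset.sum_const, card_top r hk, nsmul_eq_mul, mul_comm]
  simp only [h, sum_uniformWeight]

theorem le_spike_zero (k : ℕ) {ε : ℝ≥0} (hε : ε ≤ 1) :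
    ((1 - ε : ℝ≥0) : ℝ≥0∞) ≤ ∫⁻ v, ({0} : Set (Valuation m)).indicator 1 v
      ∂(spike m k hε : Measure (Valuation m)) := by
  change _ ≤ ∫⁻ v, ({0} : Set (Valuation m)).indicator 1 v ∂(spikeMeasure m k ε)
  rw [lintegral_spikeMeasure k ε (measurable_one.indicator (measurableSet_singleton 0))]
  simp

theorem le_expectedOpt_spike (Q : Quota) {ε : ℝ≥0} (hε0 : 0 < ε) (hε : ε ≤ 1) :
    ((1 - ε : ℝ≥0) : ℝ≥0∞) ^ (Q.n - 1) * Q.m ≤ expectedOpt fun i => spike Q.m (Q.b i) hε := by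
  classical
  have hmeas : ∀ i j : Fin Q.n, Measurable fun v : Valuation Q.m =>
      if j = i then favoriteValue (Q.b j) v else
        ({0} : Set (Valuation Q.m)).indicator (1 : Valuation Q.m → ℝ≥0∞) v := by
    intro i j
    split_ifs
    · exact measurable_favoriteValue _
    · exact measurable_one.indicator (measurableSet_singleton 0)
  refine le_trans ?_ (lintegral_mono fun V => sum_favoriteValue_le_optWelfare V)
  have hmeas' : ∀ i, Measurable fun V : ValuationProfile Q =>
      ∏ j, (if j = i then favoriteValue (Q.b j) (V j) else
        ({0} : Set (Valuation Q.m)).indicator (1 : Valuation Q.m → ℝ≥0∞) (V j)) := fun i =>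
    Finset.measurable_prod _ fun j _ => (hmeas i j).comp (measurable_pi_apply j)
  rw [lintegral_finsetSum _ fun i _ => hmeas' i]
  have hm : (Q.m : ℝ≥0∞) = ∑ i, (Q.b i : ℝ≥0∞) := Nat.cast_sum _ _
  rw [hm, Finset.mul_sum]
  refine Finset.sum_le_sum fun i _ => ?_
  rw [lintegral_pi_prod _ (fun j v => if j = i then favoriteValue (Q.b j) v else
        ({0} : Set (Valuation Q.m)).indicator (1 : Valuation Q.m → ℝ≥0∞) v) (hmeas i),
    ← Finset.mul_prod_erase _ _ (Finset.mem_univ i)]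
  simp only [if_true]
  rw [lintegral_favoriteValue_spike (Q.b_le_m i) hε0 hε, mul_comm]
  gcongr
  calc ((1 - ε : ℝ≥0) : ℝ≥0∞) ^ (Q.n - 1) =
        ∏ j ∈ Finset.univ.erase i, ((1 - ε : ℝ≥0) : ℝ≥0∞) := by
        rw [Finset.prod_const, Finset.card_erase_of_mem (Finset.mem_univ i), Finset.card_univ,
          Fintype.card_fin]
    _ ≤ _ := by
      refine Finset.prod_le_prod' fun j hj => ?_
      simp only [(Finset.mem_erase.1 hj).1, if_false]
      exact le_spike_zero _ hε

/-- The right-hand side indicates that someone has `g` as a favorite; as a product over agents it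
can be averaged by independence. -/
theorem sum_assignProb_le (M : Mechanism) {Q : Quota} (R : PrefProfile Q) (g : Fin Q.m) :
    ∑ i, (if g ∈ (R i).top (Q.b i) then 1 else 0) * assignProb M R i g ≤
      1 - ∏ i, (1 - if g ∈ (R i).top (Q.b i) then (1 : ℝ) else 0) := by
  by_cases h : ∃ i, g ∈ (R i).top (Q.b i)
  · obtain ⟨i, hi⟩ := h
    rw [Finset.prod_eq_zero (Finset.mem_univ i) (by simp [hi]), sub_zero]
    calc _ ≤ ∑ i, assignProb M R i g := Finset.sum_le_sum fun j _ => by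
          have := assignProb_nonneg M R j g
          split_ifs <;> simp [this]
      _ = expect (M.run Q R) fun a => ∑ i, if a g = some i then 1 else 0 := by
          rw [expect_sum]
          rfl
      _ ≤ expect (M.run Q R) fun _ => 1 := expect_mono _ fun a => by
          cases a g <;> simp
      _ = 1 := expect_const _ _
  · push Not at h
    simp [h]

theorem expectedWelfare_spike_le (M : Mechanism) (Q : Quota) {ε : ℝ≥0} (hε0 : 0 < ε)
    (hε : ε ≤ 1) : expectedWelfare M (fun i => spike Q.m (Q.b i) hε) ≤
      ENNReal.ofReal (Q.m * (1 - ∏ i, (1 - (Q.b i : ℝ) / Q.m))) := by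
  classical
  set P : Fin Q.n → PMF (Ranking Q.m) := fun i => rankingLaw (spike Q.m (Q.b i) hε) with hP
  have hnn : ∀ (R : PrefProfile Q) (i : Fin Q.n) (g : Fin Q.m),
      0 ≤ (if g ∈ (R i).top (Q.b i) then 1 else 0) * assignProb M R i g := by
    intro R i g
    have := assignProb_nonneg M R i g
    split_ifs <;> simp [this]
  have hwel : expectedWelfare M (fun i => spike Q.m (Q.b i) hε) =
      ENNReal.ofReal (expect (independent P) fun R =>
        ∑ i, ∑ g, (if g ∈ (R i).top (Q.b i) then 1 else 0) * assignProb M R i g) := by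
    rw [expectedWelfare_eq, ofReal_expect _ fun R =>
      Finset.sum_nonneg fun i _ => Finset.sum_nonneg fun g _ => hnn R i g]
    have hsum : ∀ R : PrefProfile Q, ENNReal.ofReal
        (∑ i, ∑ g, (if g ∈ (R i).top (Q.b i) then 1 else 0) * assignProb M R i g) =
        ∑ i, ∑ g, (if g ∈ (R i).top (Q.b i) then 1 else 0) *
          ENNReal.ofReal (assignProb M R i g) := by
      intro R
      rw [ENNReal.ofReal_sum_of_nonneg fun i _ => Finset.sum_nonneg fun g _ => hnn R i g]
      refine Finset.sum_congr rfl fun i _ => ?_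
      rw [ENNReal.ofReal_sum_of_nonneg fun g _ => hnn R i g]
      refine Finset.sum_congr rfl fun g _ => ?_
      split_ifs <;> simp
    simp only [hsum, Finset.mul_sum]
    symm
    rw [Finset.sum_comm]
    refine Finset.sum_congr rfl fun i _ => ?_
    rw [Finset.sum_comm]
    refine Finset.sum_congr rfl fun g _ => Finset.sum_congr rfl fun R _ => ?_
    rw [independent_apply, ← Finset.prod_erase_mul _ _ (Finset.mem_univ i),
      rankedValue_spike (Q.b_le_m i) hε0 hε]
    simp only [hP, rankingLaw_spike (Q.b_le_m _) hε0 hε]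
    ring
  rw [hwel]
  refine ENNReal.ofReal_le_ofReal ?_
  calc _ ≤ expect (independent P) fun R => ∑ g : Fin Q.m,
        (1 - ∏ i, (1 - if g ∈ (R i).top (Q.b i) then (1 : ℝ) else 0)) :=
        expect_mono _ fun R => by
          rw [Finset.sum_comm]
          exact Finset.sum_le_sum fun g _ => sum_assignProb_le M R g
    _ = ∑ _g : Fin Q.m, (1 - ∏ i, (1 - (Q.b i : ℝ) / Q.m)) := by
        rw [expect_sum]
        refine Finset.sum_congr rfl fun g _ => ?_
        rw [expect_sub, expect_const, expect_independent_prod P fun i r =>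
          1 - if g ∈ r.top (Q.b i) then (1 : ℝ) else 0]
        congr 1
        refine Finset.prod_congr rfl fun i _ => ?_
        rw [expect_sub, expect_const, expect_mem_top (Q.b_le_m i)
          (unbiasedFavorites_spike (Q.b_le_m i) hε0 hε) g]
    _ = _ := by
        rw [Finset.sum_const, Finset.card_univ, Fintype.card_fin, nsmul_eq_mul]

theorem le_bestDistortionOn (Q : Quota) (hK0 : 0 < 1 - ∏ i, (1 - (Q.b i : ℝ) / Q.m)) :
    ENNReal.ofReal ((1 - ∏ i, (1 - (Q.b i : ℝ) / Q.m))⁻¹) ≤ bestDistortionOn Q := by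
  refine le_iInf fun M => ?_
  set K := 1 - ∏ i, (1 - (Q.b i : ℝ) / Q.m) with hK
  have hle : ∀ ε ∈ Set.Ioc (0 : ℝ≥0) 1,
      ENNReal.ofReal ((1 - (ε : ℝ)) ^ (Q.n - 1) * K⁻¹) ≤ distortionOn M Q := by
    rintro ε ⟨hε0, hε⟩
    refine le_trans ?_ (le_iSup₂_of_le (fun i => spike Q.m (Q.b i) hε)
      (fun i => unbiasedFavorites_spike (Q.b_le_m i) hε0 hε) le_rfl)
    refine le_trans (le_of_eq ?_) (ENNReal.div_le_div (le_expectedOpt_spike Q hε0 hε)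
      (expectedWelfare_spike_le M Q hε0 hε))
    have hcoe : ((1 - ε : ℝ≥0) : ℝ≥0∞) = ENNReal.ofReal (1 - (ε : ℝ)) := by
      rw [← NNReal.coe_one, ← NNReal.coe_sub hε, ENNReal.ofReal_coe_nnreal]
    have h1 : (0 : ℝ) ≤ 1 - ε := sub_nonneg.2 (by exact_mod_cast hε)
    have hm := Q.m_pos_real
    rw [hcoe, ← ENNReal.ofReal_pow h1, ← ENNReal.ofReal_natCast Q.m,
      ← ENNReal.ofReal_mul (pow_nonneg h1 _), ← ENNReal.ofReal_div_of_pos (mul_pos hm hK0)]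
    congr 1
    field_simp
  have hcont : Filter.Tendsto (fun ε : ℝ≥0 => ENNReal.ofReal ((1 - (ε : ℝ)) ^ (Q.n - 1) * K⁻¹))
      (nhdsWithin 0 (Set.Ioi 0)) (nhds (ENNReal.ofReal K⁻¹)) := by
    have hc : Continuous fun ε : ℝ≥0 => ENNReal.ofReal ((1 - (ε : ℝ)) ^ (Q.n - 1) * K⁻¹) :=
      ENNReal.continuous_ofReal.comp (by fun_prop)
    have := (hc.tendsto 0).mono_left (nhdsWithin_le_nhds (s := Set.Ioi 0))
    simpa using this
  refine le_of_tendsto hcont ?_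
  filter_upwards [Ioc_mem_nhdsGT (zero_lt_one' ℝ≥0)] with ε hε
  exact hle ε hε

end LowerBound

/-! ### Analytic inequalities -/

section Analysis

/-- The extremal product of numbers `1 - c j` with `c j ≤ y`. -/
theorem pow_mul_le_prod_one_sub {ι : Type} [DecidableEq ι] {y : ℝ} (hy : y ≤ 1) (c : ι → ℝ)
    (S : Finset ι) (h0 : ∀ j ∈ S, 0 ≤ c j) (h1 : ∀ j ∈ S, c j ≤ y) (k : ℕ) (r : ℝ)
    (hr0 : 0 ≤ r) (hr : r < y) (hsum : ∑ j ∈ S, c j = k * y + r) :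
    (1 - y) ^ k * (1 - r) ≤ ∏ j ∈ S, (1 - c j) := by
  induction S using Finset.induction_on generalizing k r with
  | empty =>
    rw [Finset.prod_empty]
    exact mul_le_one₀ (pow_le_one₀ (by linarith) (by linarith)) (by linarith) (by linarith)
  | insert a S ha ih =>
    rw [Finset.sum_insert ha] at hsum
    rw [Finset.prod_insert ha]
    have hca0 := h0 a (Finset.mem_insert_self a S)
    have hca1 := h1 a (Finset.mem_insert_self a S)
    have h0' : ∀ j ∈ S, 0 ≤ c j := fun j hj => h0 j (Finset.mem_insert_of_mem hj)
    have h1' : ∀ j ∈ S, c j ≤ y := fun j hj => h1 j (Finset.mem_insert_of_mem hj)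
    have hS : 0 ≤ ∑ j ∈ S, c j := Finset.sum_nonneg h0'
    -- If `c a` fits into the remainder, splitting r into two parts only increases the product.
    -- Otherwise the pair (c a, r + y - c a) has the same sum as (r, y) but is less spread, so its
    -- product is larger, and one copy of y is used up.
    by_cases hrc : c a ≤ r
    · have := ih h0' h1' k (r - c a) (by linarith) (by linarith) (by linarith)
      calc (1 - y) ^ k * (1 - r) ≤ (1 - y) ^ k * ((1 - c a) * (1 - (r - c a))) := by
            refine mul_le_mul_of_nonneg_left ?_ (pow_nonneg (by linarith) k)
            nlinarith [mul_nonneg hca0 (sub_nonneg.2 hrc)]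
        _ = (1 - c a) * ((1 - y) ^ k * (1 - (r - c a))) := by ring
        _ ≤ _ := mul_le_mul_of_nonneg_left this (by linarith)
    · rw [not_le] at hrc
      obtain ⟨k, rfl⟩ : ∃ k', k = k' + 1 := by
        refine Nat.exists_eq_succ_of_ne_zero fun hk => ?_
        rw [hk] at hsum
        simp only [Nat.cast_zero, zero_mul, zero_add] at hsum
        linarith
      push_cast at hsum
      have := ih h0' h1' k (r + y - c a) (by linarith) (by linarith) (by linarith)
      calc (1 - y) ^ (k + 1) * (1 - r) = (1 - y) ^ k * ((1 - y) * (1 - r)) := by ring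
        _ ≤ (1 - y) ^ k * ((1 - c a) * (1 - (r + y - c a))) := by
            refine mul_le_mul_of_nonneg_left ?_ (pow_nonneg (by linarith) k)
            nlinarith [mul_nonneg (sub_nonneg.2 hrc.le) (sub_nonneg.2 hca1)]
        _ = (1 - c a) * ((1 - y) ^ k * (1 - (r + y - c a))) := by ring
        _ ≤ _ := mul_le_mul_of_nonneg_left this (by linarith)

/-- Series of -log(1 - x) to order 8: for x ≤ 1/2 the terms of order 5 to 8 and the remainder are
together at most x^4/4, which raises the coefficient of x^4 from 1/4 to 1/2. -/
theorem exp_neg_le_one_sub {x : ℝ} (h0 : 0 ≤ x) (h1 : x ≤ 1 / 2) :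
    Real.exp (-(x + x ^ 2 / 2 + x ^ 3 / 3 + x ^ 4 / 2)) ≤ 1 - x := by
  have hx : |x| < 1 := by rw [abs_of_nonneg h0]; linarith
  have h := (abs_le.1 (Real.abs_log_sub_add_sum_range_le hx 8)).1
  simp only [Finset.sum_range_succ, Finset.sum_range_zero, abs_of_nonneg h0] at h
  norm_num at h
  have h2 : x ^ 9 / (1 - x) ≤ 2 * x ^ 9 := by
    rw [div_le_iff₀ (by linarith)]
    nlinarith [pow_nonneg h0 9]
  have hpow : ∀ n : ℕ, x ^ (4 + n) ≤ (1 / 2) ^ n * x ^ 4 := by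
    intro n
    rw [pow_add, mul_comm]
    exact mul_le_mul_of_nonneg_right (pow_le_pow_left₀ h0 h1 n) (pow_nonneg h0 4)
  have p5 := hpow 1
  have p6 := hpow 2
  have p7 := hpow 3
  have p8 := hpow 4
  have p9 := hpow 5
  norm_num at p5 p6 p7 p8 p9
  rw [← Real.le_log_iff_exp_le (by linarith)]
  have p4 := pow_nonneg h0 4
  linarith

/-- The truncated moments of the exponential distribution. -/
def expMoment (σ : ℝ) (k : ℕ) : ℝ := ∫ t in (0 : ℝ)..1, t ^ k * Real.exp (-σ * t)

theorem continuous_expMoment (σ : ℝ) (k : ℕ) :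
    Continuous fun t : ℝ => t ^ k * Real.exp (-σ * t) := by fun_prop

theorem expMoment_nonneg (σ : ℝ) (k : ℕ) : 0 ≤ expMoment σ k :=
  intervalIntegral.integral_nonneg zero_le_one fun _ ht =>
    mul_nonneg (pow_nonneg ht.1 k) (Real.exp_pos _).le

theorem expMoment_succ_le (σ : ℝ) (k : ℕ) : expMoment σ (k + 1) ≤ expMoment σ k := by
  refine intervalIntegral.integral_mono_on zero_le_one
    ((continuous_expMoment σ _).intervalIntegrable _ _)
    ((continuous_expMoment σ _).intervalIntegrable _ _) fun t ht => ?_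
  exact mul_le_mul_of_nonneg_right (pow_le_pow_of_le_one ht.1 ht.2 (Nat.le_succ k))
    (Real.exp_pos _).le

theorem mul_expMoment_zero (σ : ℝ) : σ * expMoment σ 0 = 1 - Real.exp (-σ) := by
  have h : ∀ t ∈ Set.uIcc (0 : ℝ) 1,
      HasDerivAt (fun t => -Real.exp (-σ * t)) (σ * (t ^ 0 * Real.exp (-σ * t))) t := by
    intro t _
    refine ((((hasDerivAt_id' t).const_mul (-σ)).exp).neg).congr_deriv ?_
    ring
  have hint := intervalIntegral.integral_eq_sub_of_hasDerivAt h
    (((continuous_expMoment σ 0).const_mul σ).intervalIntegrable _ _)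
  rw [intervalIntegral.integral_const_mul] at hint
  rw [expMoment, hint]
  simp
  ring

/-- Integration by parts. Eliminating e^(-σ) between consecutive relations gives the linear
inequalities between moments used below. -/
theorem mul_expMoment_succ (σ : ℝ) (k : ℕ) :
    σ * expMoment σ (k + 1) = (k + 1) * expMoment σ k - Real.exp (-σ) := by
  have h : ∀ t ∈ Set.uIcc (0 : ℝ) 1, HasDerivAt (fun t => t ^ (k + 1) * Real.exp (-σ * t))
      ((k + 1) * (t ^ k * Real.exp (-σ * t)) - σ * (t ^ (k + 1) * Real.exp (-σ * t))) t := by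
    intro t _
    refine ((hasDerivAt_pow (k + 1) t).mul (((hasDerivAt_id' t).const_mul (-σ)).exp)).congr_deriv ?_
    rw [Nat.add_sub_cancel]
    push_cast
    ring
  have hint := intervalIntegral.integral_eq_sub_of_hasDerivAt h
    ((((continuous_expMoment σ k).const_mul _).sub
      ((continuous_expMoment σ (k + 1)).const_mul σ)).intervalIntegrable _ _)
  rw [intervalIntegral.integral_sub (((continuous_expMoment σ k).const_mul _).intervalIntegrable _ _)
    (((continuous_expMoment σ (k + 1)).const_mul σ).intervalIntegrable _ _),
    intervalIntegral.integral_const_mul, intervalIntegral.integral_const_mul] at hint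
  simp only [one_pow, one_mul, mul_one, ne_eq, Nat.add_eq_zero_iff, one_ne_zero, and_false,
    not_false_eq_true, zero_pow, zero_mul, sub_zero] at hint
  rw [expMoment, expMoment]
  linarith

/-- The polynomial inequality behind the loss of a single competitor. -/
theorem competitor_poly_nonneg {c δ : ℝ} (hc0 : 0 ≤ c) (hc : c ≤ 1 / 2) (hδ0 : 0 ≤ δ)
    (hδ : δ ≤ c) :
    0 ≤ c / 2 + 3 / 4 * δ - (1 - (c - δ) / 3) ^ 2 * c / 2 - (1 - (c - δ) / 3) ^ 3 * c ^ 2 / 4 -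
      3 / 10 * (1 - (c - δ) / 3) ^ 4 * c ^ 3 := by
  set u := c - δ with hu
  have hu0 : 0 ≤ u := by linarith
  have hu1 : u ≤ c := by linarith
  have hδu : δ = c - u := by linarith
  have hp0 : 0 ≤ 1 - u / 3 := by linarith
  have hp1 : 1 - u / 3 ≤ 1 := by linarith
  have hp3 : (1 - u / 3) ^ 3 ≤ 1 - 5 / 6 * u := by
    nlinarith [mul_nonneg hu0 hu0, mul_nonneg hu0 (mul_nonneg hu0 hu0)]
  have hp4 : (1 - u / 3) ^ 4 ≤ 1 - 5 / 6 * u := by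
    refine le_trans ?_ hp3
    exact pow_le_pow_of_le_one hp0 hp1 (by norm_num)
  have hc2 : 0 ≤ c ^ 2 := by positivity
  have hc3 : 0 ≤ c ^ 3 := by positivity
  have e3 := mul_le_mul_of_nonneg_right hp3 hc2
  have e4 := mul_le_mul_of_nonneg_right hp4 hc3
  -- With u = c - δ, this is exactly its value at δ = 0 (`hb`), plus a term with factor δ (`hd`),
  -- plus what the square of u leaves over (`hq`).
  have hmain : 0 ≤ c / 2 + 3 / 4 * δ - (1 - u / 3) ^ 2 * c / 2 - (1 - 5 / 6 * u) * c ^ 2 / 4 -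
      3 / 10 * ((1 - 5 / 6 * u) * c ^ 3) := by
    have hb : 0 ≤ c ^ 2 * (1 / 12 - 53 / 360 * c + c ^ 2 / 4) :=
      mul_nonneg hc2 (by nlinarith [sq_nonneg (c - 53 / 180)])
    have hd : 0 ≤ δ * (3 / 4 - c / 3 - 5 / 6 * (c ^ 2 / 4 + 3 / 10 * c ^ 3)) := by
      refine mul_nonneg hδ0 ?_
      nlinarith [mul_nonneg hc0 hc0, mul_nonneg hc2 hc0, mul_nonneg hc0 (sub_nonneg.2 hc),
        mul_nonneg hc2 (sub_nonneg.2 hc)]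
    have hq : 0 ≤ c * (c ^ 2 - u ^ 2) / 18 := by
      have : u ^ 2 ≤ c ^ 2 := pow_le_pow_left₀ hu0 hu1 2
      have := mul_nonneg hc0 (sub_nonneg.2 this)
      linarith
    rw [hδu] at hd ⊢
    nlinarith
  linarith

/-- Random survivors are given an item with at least the limiting Poisson probability. -/
theorem expMoment_zero_le {ι : Type} (S : Finset ι) (c : ι → ℝ) {ci δ σ : ℝ}
    (hδ : 0 ≤ δ) (hδi : δ ≤ ci) (hi : ci ≤ 1 / 2) (hδc : ∀ j ∈ S, δ ≤ c j)
    (hc : ∀ j ∈ S, c j ≤ 1 / 2) (hsum : ci + ∑ j ∈ S, c j = σ) (hσ1 : σ ≤ 1) :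
    expMoment σ 0 ≤ (1 - (ci - δ) / 3) *
      ∫ t in (0 : ℝ)..1, ∏ j ∈ S, (1 - (1 - (c j - δ) / 3) * c j * t) := by
  have hS0 : 0 ≤ ∑ j ∈ S, c j := Finset.sum_nonneg fun j hj => hδ.trans (hδc j hj)
  have hσ0 : 0 ≤ σ := by linarith
  have m0 := mul_expMoment_succ σ 0
  have m1 := mul_expMoment_succ σ 1
  have m2 := mul_expMoment_succ σ 2
  have m3 := mul_expMoment_succ σ 3
  have m4 := mul_expMoment_succ σ 4
  norm_num at m0 m1 m2 m3 m4
  set p : ι → ℝ := fun j => 1 - (c j - δ) / 3 with hp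
  have a0 := expMoment_nonneg σ 0
  have a1 := expMoment_nonneg σ 1
  have a2 := expMoment_nonneg σ 2
  have a3 := expMoment_nonneg σ 3
  have d2 := mul_nonneg hσ0 (sub_nonneg.2 (expMoment_succ_le σ 2))
  have d3 := mul_nonneg hσ0 (sub_nonneg.2 (expMoment_succ_le σ 3))
  have d4 := mul_nonneg hσ0 (sub_nonneg.2 (expMoment_succ_le σ 4))
  norm_num at d2 d3 d4
  -- With M_k = `expMoment σ k`: since M_(k+1) ≤ M_k, two consecutive recurrences give (k+1) M_k ≤ k
  -- M_(k-1); here k = 2, 3, 4. The bounds `f1` and `f5` also use σ ≤ 1.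
  have f2 : 3 / 2 * expMoment σ 2 ≤ expMoment σ 1 := by linarith
  have f3 : expMoment σ 3 ≤ 3 / 4 * expMoment σ 2 := by linarith
  have f4 : expMoment σ 4 ≤ 3 / 5 * expMoment σ 2 := by linarith
  have f1 : 2 / 5 * expMoment σ 0 ≤ expMoment σ 1 := by
    have h1 : expMoment σ 1 / 2 ≤ expMoment σ 2 := by nlinarith
    nlinarith
  have f5 : 9 / 4 * expMoment σ 2 ≤ expMoment σ 0 - σ * expMoment σ 1 := by nlinarith
  -- A lower bound for the logarithm of the ratio of the two integrands. By e^L ≥ 1 + L it suffices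
  -- that L has non-negative integral against e^(-σt).
  set L : ℝ → ℝ := fun t => σ * t - 2 / 5 * (ci - δ) - ∑ j ∈ S,
    (p j * c j * t + (p j * c j * t) ^ 2 / 2 + (p j * c j * t) ^ 3 / 3 +
      (p j * c j * t) ^ 4 / 2) with hL
  have hLc : Continuous L := by
    rw [hL]
    fun_prop
  have hpoint : ∀ t ∈ Set.Icc (0 : ℝ) 1, Real.exp (-σ * t) * (1 + L t) ≤
      (1 - (ci - δ) / 3) * ∏ j ∈ S, (1 - p j * c j * t) := by
    intro t ht
    -- For u = ci - δ ≤ 1/2, (1 + 2u/5)(1 - u/3) = 1 + u(1 - 2u)/15 ≥ 1. The constant 2/5 is also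
    -- the one in `f1`.
    have h1 : Real.exp (-(2 / 5 * (ci - δ))) ≤ 1 - (ci - δ) / 3 := by
      have hu0 : 0 ≤ ci - δ := by linarith
      rw [Real.exp_neg, inv_le_comm₀ (Real.exp_pos _) (by linarith)]
      refine le_trans ?_ (Real.add_one_le_exp _)
      rw [inv_le_iff_one_le_mul₀ (by linarith)]
      nlinarith
    have h2 : Real.exp (-∑ j ∈ S, (p j * c j * t + (p j * c j * t) ^ 2 / 2 +
        (p j * c j * t) ^ 3 / 3 + (p j * c j * t) ^ 4 / 2)) ≤ ∏ j ∈ S, (1 - p j * c j * t) := by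
      rw [← Finset.sum_neg_distrib, Real.exp_sum]
      refine Finset.prod_le_prod (fun j _ => (Real.exp_pos _).le) fun j hj => ?_
      have hcj := hc j hj
      have hδj := hδc j hj
      have hpj0 : 0 ≤ p j := by simp only [hp]; linarith
      have hpj1 : p j ≤ 1 := by simp only [hp]; linarith
      have hpc0 : 0 ≤ p j * c j := mul_nonneg hpj0 (by linarith)
      have hpc1 : p j * c j ≤ 1 / 2 := by nlinarith
      exact exp_neg_le_one_sub (mul_nonneg hpc0 ht.1) (by nlinarith [ht.1, ht.2])
    calc Real.exp (-σ * t) * (1 + L t) ≤ Real.exp (-σ * t) * Real.exp (L t) := by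
          gcongr
          rw [add_comm]
          exact Real.add_one_le_exp _
      _ = Real.exp (-(2 / 5 * (ci - δ))) * Real.exp (-∑ j ∈ S, (p j * c j * t +
          (p j * c j * t) ^ 2 / 2 + (p j * c j * t) ^ 3 / 3 + (p j * c j * t) ^ 4 / 2)) := by
          rw [← Real.exp_add, ← Real.exp_add]
          congr 1
          simp only [hL]
          ring
      _ ≤ _ := mul_le_mul h1 h2 (Real.exp_pos _).le (by linarith)
  have hint : ∫ t in (0 : ℝ)..1, Real.exp (-σ * t) * (1 + L t) ≤ (1 - (ci - δ) / 3) *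
      ∫ t in (0 : ℝ)..1, ∏ j ∈ S, (1 - p j * c j * t) := by
    rw [← intervalIntegral.integral_const_mul]
    refine intervalIntegral.integral_mono_on zero_le_one ?_ ?_ hpoint
    · exact Continuous.intervalIntegrable (by fun_prop) _ _
    · exact Continuous.intervalIntegrable (continuous_const.mul
        (continuous_finsetProd _ fun j _ => by fun_prop)) _ _
  refine le_trans ?_ hint
  have hexpand : ∫ t in (0 : ℝ)..1, Real.exp (-σ * t) * (1 + L t) =
      expMoment σ 0 + (σ * expMoment σ 1 - 2 / 5 * (ci - δ) * expMoment σ 0 - ∑ j ∈ S,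
        (p j * c j * expMoment σ 1 + (p j * c j) ^ 2 / 2 * expMoment σ 2 +
          (p j * c j) ^ 3 / 3 * expMoment σ 3 + (p j * c j) ^ 4 / 2 * expMoment σ 4)) := by
    have hi : ∀ (a : ℝ) (k : ℕ), IntervalIntegrable
        (fun t : ℝ => a * (t ^ k * Real.exp (-σ * t))) volume 0 1 := fun a k =>
      ((continuous_expMoment σ k).const_mul a).intervalIntegrable _ _
    have hrw : ∀ t : ℝ, Real.exp (-σ * t) * (1 + L t) =
        (1 - 2 / 5 * (ci - δ)) * (t ^ 0 * Real.exp (-σ * t)) +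
        σ * (t ^ 1 * Real.exp (-σ * t)) - ∑ j ∈ S,
        (p j * c j * (t ^ 1 * Real.exp (-σ * t)) +
          (p j * c j) ^ 2 / 2 * (t ^ 2 * Real.exp (-σ * t)) +
          (p j * c j) ^ 3 / 3 * (t ^ 3 * Real.exp (-σ * t)) +
          (p j * c j) ^ 4 / 2 * (t ^ 4 * Real.exp (-σ * t))) := by
      intro t
      have : ∑ j ∈ S, (p j * c j * (t ^ 1 * Real.exp (-σ * t)) +
          (p j * c j) ^ 2 / 2 * (t ^ 2 * Real.exp (-σ * t)) +
          (p j * c j) ^ 3 / 3 * (t ^ 3 * Real.exp (-σ * t)) +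
          (p j * c j) ^ 4 / 2 * (t ^ 4 * Real.exp (-σ * t))) = Real.exp (-σ * t) * ∑ j ∈ S,
          (p j * c j * t + (p j * c j * t) ^ 2 / 2 + (p j * c j * t) ^ 3 / 3 +
          (p j * c j * t) ^ 4 / 2) := by
        rw [Finset.mul_sum]
        exact Finset.sum_congr rfl fun j _ => by ring
      rw [this]
      simp only [hL]
      ring
    simp only [hrw]
    rw [intervalIntegral.integral_sub, intervalIntegral.integral_add (hi _ 0) (hi _ 1),
      intervalIntegral.integral_finsetSum]
    · have hterm : ∀ j ∈ S, ∫ t in (0 : ℝ)..1, (p j * c j * (t ^ 1 * Real.exp (-σ * t)) +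
          (p j * c j) ^ 2 / 2 * (t ^ 2 * Real.exp (-σ * t)) +
          (p j * c j) ^ 3 / 3 * (t ^ 3 * Real.exp (-σ * t)) +
          (p j * c j) ^ 4 / 2 * (t ^ 4 * Real.exp (-σ * t))) =
          p j * c j * expMoment σ 1 + (p j * c j) ^ 2 / 2 * expMoment σ 2 +
          (p j * c j) ^ 3 / 3 * expMoment σ 3 + (p j * c j) ^ 4 / 2 * expMoment σ 4 := by
        intro j _
        rw [intervalIntegral.integral_add (((hi _ 1).add (hi _ 2)).add (hi _ 3)) (hi _ 4),
          intervalIntegral.integral_add ((hi _ 1).add (hi _ 2)) (hi _ 3),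
          intervalIntegral.integral_add (hi _ 1) (hi _ 2)]
        simp only [intervalIntegral.integral_const_mul]
        rfl
      rw [Finset.sum_congr rfl hterm]
      simp only [intervalIntegral.integral_const_mul]
      change (1 - 2 / 5 * (ci - δ)) * expMoment σ 0 + σ * expMoment σ 1 - _ = _
      ring
    · exact fun j _ => (((hi _ 1).add (hi _ 2)).add (hi _ 3)).add (hi _ 4)
    · exact (hi _ 0).add (hi _ 1)
    · exact Continuous.intervalIntegrable (by fun_prop) _ _
  rw [hexpand]
  -- Lowering p_j below 1 saves c_j^2 M_1/3 ≥ c_j^2 M_2/2 at first order, which pays for the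
  -- higher-order losses up to an error proportional to δ. Expressed in M_2, this is
  -- `competitor_poly_nonneg`.
  have hper : ∀ j ∈ S, p j * c j * expMoment σ 1 + (p j * c j) ^ 2 / 2 * expMoment σ 2 +
      (p j * c j) ^ 3 / 3 * expMoment σ 3 + (p j * c j) ^ 4 / 2 * expMoment σ 4 ≤
      c j * (expMoment σ 1 + δ * (expMoment σ 1 / 3 + 3 / 4 * expMoment σ 2)) := by
    intro j hj
    have hcj := hc j hj
    have hδj := hδc j hj
    have hcj0 : 0 ≤ c j := hδ.trans hδj
    have hpj0 : 0 ≤ p j := by simp only [hp]; linarith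
    have hpoly := mul_nonneg (mul_nonneg hcj0 a2) (competitor_poly_nonneg hcj0 hcj hδ hδj)
    have g3 := mul_le_mul_of_nonneg_left f3
      (show 0 ≤ (p j * c j) ^ 3 / 3 by positivity)
    have g4 := mul_le_mul_of_nonneg_left f4
      (show 0 ≤ (p j * c j) ^ 4 / 2 by positivity)
    have g2 := mul_le_mul_of_nonneg_left f2 (show 0 ≤ c j ^ 2 / 3 by positivity)
    have hpj : 1 - (c j - δ) / 3 = p j := rfl
    rw [hpj] at hpoly
    have hlin : p j * c j * expMoment σ 1 = c j * expMoment σ 1 - c j ^ 2 / 3 * expMoment σ 1 +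
        c j * δ / 3 * expMoment σ 1 := by
      simp only [hp]
      ring
    rw [hlin]
    linarith
  have htot := Finset.sum_le_sum hper
  rw [← Finset.sum_mul] at htot
  have hsum' : ∑ j ∈ S, c j = σ - ci := by linarith
  rw [hsum'] at htot
  -- Agent i does not compete with herself, which leaves a surplus ci M_1. By `f1` the part (ci - δ)
  -- M_1 pays for p_i; the part δ M_1 pays for the errors of the competitors, as σ(M_1/3 + 3 M_2/4)
  -- ≤ M_0/3 ≤ M_1 by `f5` and `f1`.
  have q1 := mul_nonneg (show 0 ≤ ci - δ by linarith) (sub_nonneg.2 f1)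
  have q2 := mul_nonneg (mul_nonneg hδ (hδ.trans hδi))
    (show 0 ≤ expMoment σ 1 / 3 + 3 / 4 * expMoment σ 2 by positivity)
  have q3 := mul_nonneg (mul_nonneg hδ (sub_nonneg.2 hσ1)) a2
  have q4 := mul_le_mul_of_nonneg_left f5 hδ
  have q5 := mul_le_mul_of_nonneg_left f1 hδ
  have q6 := mul_nonneg hδ a0
  linarith

end Analysis

/-! ### The bound on the distortion gap -/

section GapBound

theorem exp_neg_one_bounds : 0.36787 < Real.exp (-1) ∧ Real.exp (-1) < 0.36788 := by
  have h1 := Real.exp_one_gt_d9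
  have h2 := Real.exp_one_lt_d9
  have h : Real.exp (-1) * Real.exp 1 = 1 := by rw [← Real.exp_add]; simp
  have hpos := Real.exp_pos (-1)
  constructor <;> nlinarith

theorem exp_neg_half_bounds :
    0.6065 < Real.exp (-(1 / 2)) ∧ Real.exp (-(1 / 2)) < 0.60654 := by
  obtain ⟨h1, h2⟩ := exp_neg_one_bounds
  have h : Real.exp (-(1 / 2)) * Real.exp (-(1 / 2)) = Real.exp (-1) := by
    rw [← Real.exp_add]
    norm_num
  have hpos := Real.exp_pos (-(1 / 2))
  constructor <;> nlinarith

theorem mul_exp_le_exp_neg_one (y : ℝ) : (1 - y) * Real.exp (-1 + y) ≤ Real.exp (-1) := by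
  have h : Real.exp (-1 + y) * Real.exp (-y) = Real.exp (-1) := by
    rw [← Real.exp_add]
    ring_nf
  rw [← h, mul_comm]
  exact mul_le_mul_of_nonneg_left (by linarith [Real.add_one_le_exp (-y)]) (Real.exp_pos _).le

theorem denom_pos (y : ℝ) : 0 < 1 - (1 - y) * Real.exp (-1 + y) := by
  linarith [mul_exp_le_exp_neg_one y, exp_neg_one_bounds.2]

theorem gapBound_half : gapBound (1 / 2) = (3 / 4) / (1 - Real.exp (-(1 / 2)) / 2) := by
  have h : ⌊(1 : ℝ) / (1 / 2)⌋₊ = 2 := by norm_num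
  have h2 : (-1 : ℝ) + 1 / 2 = -(1 / 2) := by norm_num
  rw [gapBound, h, h2]
  norm_num
  ring

theorem gapBound_half_eq : gapBound (1 / 2) =
    3 / 4 * (2 * Real.sqrt (Real.exp 1) / (2 * Real.sqrt (Real.exp 1) - 1)) := by
  have hs : Real.sqrt (Real.exp 1) = (Real.exp (-(1 / 2)))⁻¹ := by
    rw [← Real.exp_half, ← Real.exp_neg, neg_neg]
  have h := exp_neg_half_bounds
  have hpos := Real.exp_pos (-(1 / 2))
  rw [gapBound_half, hs]
  generalize Real.exp (-(1 / 2)) = E at *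
  have h1 : 1 - E / 2 ≠ 0 := by linarith
  have h2 : 2 * E⁻¹ - 1 ≠ 0 := by
    have : 2 * E⁻¹ - 1 = 2 * (1 - E / 2) * E⁻¹ := by field_simp
    rw [this]
    exact mul_ne_zero (mul_ne_zero two_ne_zero h1) (inv_ne_zero hpos.ne')
  rw [mul_div_assoc', div_eq_div_iff h1 h2]
  field_simp

theorem gapBound_half_le : gapBound (1 / 2) ≤ 1.0765 := by
  have h := exp_neg_half_bounds
  rw [gapBound_half, div_le_iff₀ (by linarith)]
  linarith

theorem le_gapBound_half : 1.0764 ≤ gapBound (1 / 2) := by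
  have h := exp_neg_half_bounds
  rw [gapBound_half, le_div_iff₀ (by linarith)]
  linarith

theorem one_sub_mul_exp_le {y : ℝ} (h0 : 0 ≤ y) (h1 : y ≤ 1) :
    (1 - y) * Real.exp y ≤ 1 - y ^ 2 / 2 - y ^ 3 / 3 := by
  have h := Real.exp_bound' h0 h1 (n := 4) (by norm_num)
  simp only [Finset.sum_range_succ, Finset.sum_range_zero] at h
  norm_num [Nat.factorial] at h
  have h2 := mul_le_mul_of_nonneg_left h (sub_nonneg.2 h1)
  refine h2.trans ?_
  have p4 : 0 ≤ y ^ 4 := pow_nonneg h0 4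
  have p5 : 0 ≤ y ^ 5 := pow_nonneg h0 5
  nlinarith

/-- Removing the floor: if 1/y = k + θ, Bernoulli gives (1-y)^θ ≤ 1 - θy = ky, so the right-hand
side is at least (1-y)^(1/y), which is expanded around e^(-1). -/
theorem exp_neg_one_mul_le_pow_mul_floor {y : ℝ} (h0 : 0 < y) (h1 : y ≤ 1 / 3) :
    Real.exp (-1) * (1 - y / 2 - 3 / 8 * y ^ 2 + 19 / 100 * y ^ 3) ≤
      (1 - y) ^ ⌊1 / y⌋₊ * (⌊1 / y⌋₊ : ℝ) * y := by
  set k := ⌊1 / y⌋₊ with hk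
  have hk1 : (k : ℝ) ≤ 1 / y := Nat.floor_le (by positivity)
  have hk2 : 1 / y < k + 1 := Nat.lt_floor_add_one _
  have hy1 : 0 < 1 - y := by linarith
  set θ := 1 / y - k with hθ
  have hbern : (1 - y) ^ θ ≤ k * y := by
    have := rpow_one_add_le_one_add_mul_self (s := -y) (p := θ) (by linarith) (by linarith)
      (by linarith)
    have h2 : 1 + θ * -y = k * y := by
      rw [hθ]
      field_simp
      ring
    rw [h2] at this
    exact this
  have hpow : Real.exp (Real.log (1 - y) * (1 / y)) = (1 - y) ^ k * (1 - y) ^ θ := by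
    rw [← Real.rpow_def_of_pos hy1, ← Real.rpow_natCast, ← Real.rpow_add hy1]
    congr 1
    rw [hθ]
    ring
  set w := y / 2 + y ^ 2 / 2 with hw
  have hlog : -1 - w ≤ Real.log (1 - y) * (1 / y) := by
    have h2 := exp_neg_le_one_sub h0.le (by linarith : y ≤ 1 / 2)
    rw [← Real.le_log_iff_exp_le hy1] at h2
    rw [mul_one_div, le_div_iff₀ h0]
    refine le_trans ?_ h2
    have : y ^ 4 ≤ y ^ 3 / 3 := by
      have := mul_le_mul_of_nonneg_left h1 (pow_nonneg h0.le 3)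
      linarith [pow_succ y 3]
    rw [hw]
    nlinarith
  have hw0 : 0 ≤ w := by positivity
  have hw1 : w ≤ 2 / 3 * y := by nlinarith
  have hexp : 1 - y / 2 - 3 / 8 * y ^ 2 + 19 / 100 * y ^ 3 ≤ Real.exp (-w) := by
    have hb := Real.exp_bound (x := -w) (by rw [abs_neg, abs_of_nonneg hw0]; linarith)
      (n := 4) (by norm_num)
    have hb := (abs_le.1 hb).1
    simp only [Finset.sum_range_succ, Finset.sum_range_zero, abs_neg, abs_of_nonneg hw0] at hb
    norm_num [Nat.factorial] at hb
    have w3 : w ^ 3 ≤ (2 / 3 * y) ^ 3 := pow_le_pow_left₀ hw0 hw1 3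
    have w4 : w ^ 4 ≤ w ^ 3 * (2 / 9) := by
      rw [pow_succ]
      exact mul_le_mul_of_nonneg_left (by linarith) (pow_nonneg hw0 3)
    have w2 : y ^ 2 / 4 + y ^ 3 / 2 ≤ w ^ 2 := by
      rw [hw]
      nlinarith [pow_nonneg h0.le 4]
    have p3 := pow_nonneg h0.le 3
    have hwlin : w = y / 2 + y ^ 2 / 2 := hw
    nlinarith
  calc Real.exp (-1) * (1 - y / 2 - 3 / 8 * y ^ 2 + 19 / 100 * y ^ 3) ≤
        Real.exp (-1) * Real.exp (-w) := by gcongr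
    _ = Real.exp (-1 - w) := by rw [← Real.exp_add]; rfl
    _ ≤ Real.exp (Real.log (1 - y) * (1 / y)) := Real.exp_le_exp.2 hlog
    _ = (1 - y) ^ k * (1 - y) ^ θ := hpow
    _ ≤ (1 - y) ^ k * (k * y) := by gcongr
    _ = _ := by ring

/-- For y ≤ 1/3 a comparison with the numerical value at 1/2 suffices. Near 1/2 the floor jumps and
G has a kink: on each side the cleared difference starts with a positive multiple of x = |y - 1/2|,
so Taylor polynomials of the exponential are enough. -/
theorem gapBound_le_half {y : ℝ} (h0 : 0 < y) (h1 : y ≤ 1) : gapBound y ≤ gapBound (1 / 2) := by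
  have hE := exp_neg_half_bounds
  have hEpos := Real.exp_pos (-(1 / 2))
  rw [gapBound, div_le_iff₀ (denom_pos y)]
  by_cases hthird : y ≤ 1 / 3
  · have hfl := exp_neg_one_mul_le_pow_mul_floor h0 hthird
    have hexp := one_sub_mul_exp_le h0.le h1
    obtain ⟨he1, he2⟩ := exp_neg_one_bounds
    have hG := le_gapBound_half
    have hD : (1 - y) * Real.exp (-1 + y) ≤ Real.exp (-1) * (1 - y ^ 2 / 2 - y ^ 3 / 3) := by
      rw [Real.exp_add, mul_left_comm]
      exact mul_le_mul_of_nonneg_left hexp (Real.exp_pos _).le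
    have hDpos := denom_pos y
    have hstep : 1.0764 * (1 - Real.exp (-1) * (1 - y ^ 2 / 2 - y ^ 3 / 3)) ≤
        gapBound (1 / 2) * (1 - (1 - y) * Real.exp (-1 + y)) :=
      (mul_le_mul_of_nonneg_left (by linarith) (by norm_num)).trans
        (mul_le_mul_of_nonneg_right hG hDpos.le)
    refine le_trans ?_ hstep
    refine le_trans (sub_le_sub_left hfl 1) ?_
    have hy2 : 0 ≤ y ^ 2 := by positivity
    have hy3 : 0 ≤ y ^ 3 := by positivity
    -- The factor multiplying e^(-1) is non-negative, so the upper bound 0.36788 may replace e^(-1).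
    have hq : 0 ≤ 1.0764 * (1 - y ^ 2 / 2 - y ^ 3 / 3) -
        (1 - y / 2 - 3 / 8 * y ^ 2 + 19 / 100 * y ^ 3) := by
      nlinarith
    have hm := mul_le_mul_of_nonneg_right he2.le hq
    have hfin : 0.36788 * (1.0764 * (1 - y ^ 2 / 2 - y ^ 3 / 3) -
        (1 - y / 2 - 3 / 8 * y ^ 2 + 19 / 100 * y ^ 3)) ≤ 0.0764 := by
      nlinarith [mul_nonneg h0.le (sub_nonneg.2 hthird),
        mul_nonneg hy2 (sub_nonneg.2 hthird)]
    linarith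
  · rw [not_le] at hthird
    have hden : 0 < 1 - Real.exp (-(1 / 2)) / 2 := by linarith
    rw [gapBound_half, div_mul_eq_mul_div, le_div_iff₀ hden]
    by_cases hhalf : y ≤ 1 / 2
    · have hk : ⌊1 / y⌋₊ = 2 := by
        rw [Nat.floor_eq_iff (by positivity)]
        constructor
        · rw [le_div_iff₀ h0]
          push_cast
          linarith
        · rw [div_lt_iff₀ h0]
          push_cast
          linarith
      rw [hk]
      obtain ⟨x, rfl⟩ : ∃ x, y = 1 / 2 - x := ⟨1 / 2 - y, by ring⟩
      have hx0 : 0 ≤ x := by linarith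
      have hx1 : x ≤ 1 / 6 := by linarith
      have hsplit : Real.exp (-1 + (1 / 2 - x)) = Real.exp (-(1 / 2)) * Real.exp (-x) := by
        rw [← Real.exp_add]
        ring_nf
      have hexp : Real.exp (-x) ≤ 1 - x + x ^ 2 / 2 := by
        have hpos : 0 < 1 - x + x ^ 2 / 2 := by nlinarith
        rw [Real.exp_neg, inv_le_comm₀ (Real.exp_pos _) hpos]
        refine le_trans ?_ (Real.quadratic_le_exp_of_nonneg hx0)
        rw [inv_le_iff_one_le_mul₀ hpos]
        nlinarith [pow_nonneg hx0 4]
      rw [hsplit]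
      generalize Real.exp (-(1 / 2)) = E at *
      have hb : (1 - (1 / 2 - x)) * (E * Real.exp (-x)) ≤
          (1 - (1 / 2 - x)) * (E * (1 - x + x ^ 2 / 2)) := by
        gcongr
      have hx2 : 0 ≤ x ^ 2 := by positivity
      have hx3 : 0 ≤ x ^ 3 := by positivity
      have hfin : (1 - (1 - (1 / 2 - x)) ^ 2 * ((2 : ℕ) : ℝ) * (1 / 2 - x)) * (1 - E / 2) ≤
          3 / 4 * (1 - (1 - (1 / 2 - x)) * (E * (1 - x + x ^ 2 / 2))) := by
        push_cast
        nlinarith [mul_nonneg hx0 (sub_nonneg.2 hx1), mul_nonneg hx2 (sub_nonneg.2 hx1),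
          mul_nonneg hx0 (sub_nonneg.2 hE.1.le), mul_nonneg hx2 (sub_nonneg.2 hE.1.le),
          mul_nonneg hx3 (sub_nonneg.2 hE.1.le), mul_nonneg hx0 (sub_nonneg.2 hE.2.le),
          mul_nonneg hx2 (sub_nonneg.2 hE.2.le), mul_nonneg hx3 (sub_nonneg.2 hE.2.le)]
      linarith
    · rw [not_le] at hhalf
      have hk : ⌊1 / y⌋₊ = 1 := by
        rw [Nat.floor_eq_iff (by positivity)]
        constructor
        · rw [le_div_iff₀ h0]
          push_cast
          linarith
        · rw [div_lt_iff₀ h0]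
          push_cast
          linarith
      rw [hk]
      obtain ⟨x, rfl⟩ : ∃ x, y = 1 / 2 + x := ⟨y - 1 / 2, by ring⟩
      have hx0 : 0 ≤ x := by linarith
      have hx1 : x ≤ 1 / 2 := by linarith
      have hsplit : Real.exp (-1 + (1 / 2 + x)) = Real.exp (-(1 / 2)) * Real.exp x := by
        rw [← Real.exp_add]
        ring_nf
      have hexp : Real.exp x ≤ 1 + x + x ^ 2 := by
        have := (abs_le.1 (Real.abs_exp_sub_one_sub_id_le (x := x)
          (by rw [abs_of_nonneg hx0]; linarith))).2
        linarith
      rw [hsplit]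
      generalize Real.exp (-(1 / 2)) = E at *
      have hb : (1 - (1 / 2 + x)) * (E * Real.exp x) ≤
          (1 - (1 / 2 + x)) * (E * (1 + x + x ^ 2)) := by
        gcongr
      have hx2 : 0 ≤ x ^ 2 := by positivity
      have hx3 : 0 ≤ x ^ 3 := by positivity
      have hfin : (1 - (1 - (1 / 2 + x)) ^ 1 * ((1 : ℕ) : ℝ) * (1 / 2 + x)) * (1 - E / 2) ≤
          3 / 4 * (1 - (1 - (1 / 2 + x)) * (E * (1 + x + x ^ 2))) := by
        push_cast
        -- The difference of the two sides at E = 0.6; it is increasing in E, and E > 0.6065.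
        have hq : 0 ≤ x * (0.225 - 0.475 * x + 0.45 * x ^ 2) :=
          mul_nonneg hx0 (by nlinarith [sq_nonneg (x - 0.5)])
        nlinarith [mul_nonneg hx0 (sub_nonneg.2 hE.1.le), mul_nonneg hx2 (sub_nonneg.2 hE.1.le),
          mul_nonneg hx3 (sub_nonneg.2 hE.1.le)]
      linarith

end GapBound

/-! ### Well-definedness of RSBS and the distortion gap -/

section WellDefined

variable {Q : Quota}

theorem Quota.b_le_bmax (Q : Quota) (i : Fin Q.n) : Q.b i ≤ Q.bmax :=
  Finset.le_sup (f := Q.b) (Finset.mem_univ i)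

theorem Quota.exists_eq_bmax (Q : Quota) : ∃ s, Q.b s = Q.bmax := by
  have : Nonempty (Fin Q.n) := ⟨⟨0, Q.n_pos⟩⟩
  obtain ⟨s, -, hs⟩ := Finset.exists_mem_eq_sup Finset.univ Finset.univ_nonempty Q.b
  exact ⟨s, hs.symm⟩

theorem Quota.ratio_mem (Q : Quota) : Q.ratio ∈ Set.Ioc (0 : ℝ) 1 := by
  obtain ⟨s, hs⟩ := Q.exists_eq_bmax
  rw [Quota.ratio, ← hs]
  refine ⟨div_pos (Nat.cast_pos.2 (Q.b_pos s)) Q.m_pos_real, ?_⟩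
  rw [div_le_one Q.m_pos_real]
  exact_mod_cast Q.b_le_m s

theorem Quota.one_le_b (Q : Quota) (i : Fin Q.n) : (1 : ℝ) ≤ Q.b i := by
  exact_mod_cast Q.b_pos i

theorem survivalProb_eq (i : Fin Q.n) :
    survivalProb Q i = 1 - ((Q.b i : ℝ) / Q.m - 1 / Q.m) / 3 := by
  have := Q.m_pos_real.ne'
  rw [survivalProb]
  field_simp

theorem survivalProb_mem (i : Fin Q.n) : survivalProb Q i ∈ Set.Ioc (0 : ℝ) 1 := by
  have hm := Q.m_pos_real
  have h1 : (Q.b i : ℝ) ≤ Q.m := by exact_mod_cast Q.b_le_m i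
  have h2 := Q.one_le_b i
  rw [survivalProb]
  constructor
  · rw [sub_pos, div_lt_one (by positivity)]
    linarith
  · have : 0 ≤ ((Q.b i : ℝ) - 1) / (3 * (Q.m : ℝ)) := div_nonneg (by linarith) (by positivity)
    linarith

theorem stealingProb_mem : stealingProb Q ∈ Set.Ico (0 : ℝ) 1 := by
  obtain ⟨hy0, hy1⟩ := Q.ratio_mem
  rw [stealingProb]
  rcases hy1.eq_or_lt with h | h
  · rw [h]
    norm_num
  · have hE1 : Real.exp (-1 + Q.ratio) < 1 := (Real.exp_lt_exp.2 (by linarith)).trans_eq Real.exp_zero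
    have hE0 := Real.exp_pos (-1 + Q.ratio)
    have h2 : (2 - Q.ratio) * Real.exp (-1 + Q.ratio) ≤ 1 := by
      have h3 : Real.exp (-1 + Q.ratio) * Real.exp (1 - Q.ratio) = 1 := by
        rw [← Real.exp_add]
        ring_nf
        exact Real.exp_zero
      have h4 := mul_le_mul_of_nonneg_left (Real.add_one_le_exp (1 - Q.ratio)) hE0.le
      linarith
    constructor
    · exact div_nonneg (by linarith) (by linarith)
    · rw [div_lt_one (by linarith)]
      nlinarith

/-- b_i ≤ b_s and b_i + b_s ≤ m. This is why setting aside an agent of largest quota makes the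
estimates for c ≤ 1/2 available. -/
theorem Quota.div_le_half {s : Fin Q.n} (hs : Q.b s = Q.bmax) {i : Fin Q.n} (hi : i ≠ s) :
    (Q.b i : ℝ) / Q.m ≤ 1 / 2 := by
  have h1 : (Q.b i : ℝ) / Q.m ≤ Q.ratio := by
    rw [Quota.ratio]
    gcongr
    exact Q.b_le_bmax i
  have h2 := Finset.single_le_sum (s := Finset.univ.erase s) (f := fun i => (Q.b i : ℝ) / Q.m)
    (fun _ _ => by positivity) (Finset.mem_erase.2 ⟨hi, Finset.mem_univ i⟩)
  rw [Q.sum_erase_div hs] at h2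
  linarith

theorem burningProb_mem {s i : Fin Q.n} (hs : Q.b s = Q.bmax) (hi : i ≠ s) :
    burningProb Q s i ∈ Set.Ico (0 : ℝ) 1 := by
  have hm := Q.m_pos_real
  have hc0 : ∀ j, 1 / (Q.m : ℝ) ≤ (Q.b j : ℝ) / Q.m := fun j => by
    gcongr
    exact Q.one_le_b j
  have hins : Finset.univ.erase s = insert i (Finset.univ \ {i, s}) := by
    ext j
    by_cases hj : j = i <;> simp [hj, hi]
  have hsum := Q.sum_erase_div hs
  rw [hins, Finset.sum_insert (by simp)] at hsum
  obtain ⟨hy0, hy1⟩ := Q.ratio_mem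
  -- With δ = 1/m, the survival probabilities have the form 1 - (c_j - δ)/3 by `survivalProb_eq`.
  have hkey := expMoment_zero_le (Finset.univ \ {i, s}) (fun j => (Q.b j : ℝ) / Q.m)
    (ci := (Q.b i : ℝ) / Q.m) (δ := 1 / (Q.m : ℝ)) (σ := 1 - Q.ratio) (by positivity) (hc0 i)
    (Q.div_le_half hs hi) (fun j _ => hc0 j) (fun j hj => Q.div_le_half hs (by
      simp only [Finset.mem_sdiff, Finset.mem_insert, Finset.mem_singleton, not_or] at hj
      exact hj.2.2)) hsum (by linarith)
  simp only [← survivalProb_eq, ← mul_div_assoc] at hkey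
  have hσ : 0 < 1 - Q.ratio := by
    have h1 : 0 < (Q.b i : ℝ) / Q.m := lt_of_lt_of_le (by positivity) (hc0 i)
    have h2 : 0 ≤ ∑ j ∈ Finset.univ \ {i, s}, (Q.b j : ℝ) / Q.m :=
      Finset.sum_nonneg fun j _ => by positivity
    linarith
  have hA : 0 < 1 - Real.exp (-1 + Q.ratio) := sub_pos.2 ((Real.exp_lt_exp.2 (by linarith)).trans_eq Real.exp_zero)
  have hm0 := mul_expMoment_zero (1 - Q.ratio)
  rw [show -(1 - Q.ratio) = -1 + Q.ratio by ring] at hm0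
  have hle : 1 - Real.exp (-1 + Q.ratio) ≤ (1 - Q.ratio) * survivalProb Q i *
      ∫ y in (0 : ℝ)..1, ∏ j ∈ Finset.univ \ {i, s},
        (1 - survivalProb Q j * (Q.b j : ℝ) / (Q.m : ℝ) * y) := by
    rw [← hm0, mul_assoc]
    exact mul_le_mul_of_nonneg_left hkey hσ.le
  have hB := hA.trans_le hle
  rw [burningProb]
  constructor
  · rw [sub_nonneg, div_le_one hB]
    exact hle
  · have := div_pos hA hB
    linarith

/-- With k = ⌊1/y⌋ and total mass 1, the remainder is r = 1 - ky, so 1 - r = ky. -/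
theorem floor_le_prod (Q : Quota) :
    (1 - Q.ratio) ^ ⌊1 / Q.ratio⌋₊ * (⌊1 / Q.ratio⌋₊ : ℝ) * Q.ratio ≤
      ∏ i, (1 - (Q.b i : ℝ) / Q.m) := by
  obtain ⟨hy0, hy1⟩ := Q.ratio_mem
  have h1 : (⌊1 / Q.ratio⌋₊ : ℝ) * Q.ratio ≤ 1 := by
    rw [← le_div_iff₀ hy0]
    exact Nat.floor_le (by positivity)
  have h2 : 1 < ((⌊1 / Q.ratio⌋₊ : ℝ) + 1) * Q.ratio := by
    rw [← div_lt_iff₀ hy0]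
    exact Nat.lt_floor_add_one _
  have h := pow_mul_le_prod_one_sub hy1 (fun i => (Q.b i : ℝ) / Q.m) Finset.univ
    (fun _ _ => by positivity) (fun i _ => by
      rw [Quota.ratio]
      gcongr
      exact Q.b_le_bmax i) ⌊1 / Q.ratio⌋₊ (1 - ⌊1 / Q.ratio⌋₊ * Q.ratio) (by linarith)
    (by linarith) (by rw [Q.sum_div]; ring)
  linarith

theorem prod_lt_one (Q : Quota) : ∏ i, (1 - (Q.b i : ℝ) / Q.m) < 1 := by
  have hm := Q.m_pos_real
  set s : Fin Q.n := ⟨0, Q.n_pos⟩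
  rw [← Finset.mul_prod_erase _ _ (Finset.mem_univ s)]
  have h0 : ∀ i, 0 ≤ 1 - (Q.b i : ℝ) / Q.m := fun i => by
    rw [sub_nonneg, div_le_one hm]
    exact_mod_cast Q.b_le_m i
  have hs : 0 < (Q.b s : ℝ) / Q.m := div_pos (Nat.cast_pos.2 (Q.b_pos s)) hm
  have h1 : ∏ i ∈ Finset.univ.erase s, (1 - (Q.b i : ℝ) / Q.m) ≤ 1 :=
    Finset.prod_le_one (fun i _ => h0 i) fun i _ => by
      have : 0 ≤ (Q.b i : ℝ) / Q.m := by positivity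
      linarith
  have := mul_le_mul_of_nonneg_left h1 (h0 s)
  linarith

theorem div_bestDistortionOn_le {x : ℝ≥0∞}
    (hx : x ≤ ENNReal.ofReal ((1 - (1 - Q.ratio) * Real.exp (-1 + Q.ratio))⁻¹)) :
    x / bestDistortionOn Q ≤ ENNReal.ofReal (gapBound Q.ratio) := by
  have hK : 0 < 1 - ∏ i, (1 - (Q.b i : ℝ) / Q.m) := sub_pos.2 (prod_lt_one Q)
  refine (ENNReal.div_le_div hx (le_bestDistortionOn Q hK)).trans ?_
  rw [← ENNReal.ofReal_div_of_pos (inv_pos.2 hK)]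
  refine ENNReal.ofReal_le_ofReal ?_
  rw [div_inv_eq_mul, mul_comm, ← div_eq_mul_inv, gapBound]
  exact div_le_div_of_nonneg_right (sub_le_sub_left (floor_le_prod Q) 1) (denom_pos _).le

end WellDefined

end BMatching

end

theorem mainTheorem4 (sel : (Q : BMatching.Quota) → Fin Q.n)
    (hsel : ∀ Q : BMatching.Quota, Q.b (sel Q) = Q.bmax) :
    -- the quantities used by the mechanism are probabilities
    (∀ Q : BMatching.Quota,
      (∀ i, BMatching.survivalProb Q i ∈ Set.Ioc (0 : ℝ) 1) ∧
      (∀ i, i ≠ sel Q → BMatching.burningProb Q (sel Q) i ∈ Set.Ico (0 : ℝ) 1) ∧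
      BMatching.stealingProb Q ∈ Set.Ico (0 : ℝ) 1) ∧
    -- distortion on every quota vector
    (∀ Q : BMatching.Quota,
      BMatching.distortionOn (BMatching.RSBS sel) Q ≤
        ENNReal.ofReal ((1 - (1 - Q.ratio) * Real.exp (-1 + Q.ratio))⁻¹)) ∧
    -- distortion
    BMatching.distortion (BMatching.RSBS sel) ≤
      ENNReal.ofReal (Real.exp 1 / (Real.exp 1 - 1)) ∧
    -- distortion gap on every quota vector
    (∀ Q : BMatching.Quota,
      BMatching.distortionOn (BMatching.RSBS sel) Q / BMatching.bestDistortionOn Q ≤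
        ENNReal.ofReal (BMatching.gapBound Q.ratio)) ∧
    -- the maximum of the gap bound
    IsMaxOn BMatching.gapBound (Set.Ioc 0 1) (1 / 2) ∧
    BMatching.gapBound (1 / 2) =
      3 / 4 * (2 * Real.sqrt (Real.exp 1) / (2 * Real.sqrt (Real.exp 1) - 1)) ∧
    -- distortion gap
    BMatching.distortionGap (BMatching.RSBS sel) ≤
      ENNReal.ofReal
        (3 / 4 * (2 * Real.sqrt (Real.exp 1) / (2 * Real.sqrt (Real.exp 1) - 1))) ∧
    BMatching.distortionGap (BMatching.RSBS sel) ≤ ENNReal.ofReal 1.0765 := by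
  have hratio : ∀ Q : BMatching.Quota, Q.ratio ∈ Set.Ioc (0 : ℝ) 1 := fun Q => Q.ratio_mem
  have hwell : ∀ Q : BMatching.Quota,
      BMatching.distortionOn (BMatching.RSBS sel) Q ≤
        ENNReal.ofReal ((1 - (1 - Q.ratio) * Real.exp (-1 + Q.ratio))⁻¹) := fun Q =>
    BMatching.distortionOn_RSBS_le (hsel Q) BMatching.survivalProb_mem
      (fun _ hi => BMatching.burningProb_mem (hsel Q) hi) BMatching.stealingProb_mem
      (BMatching.denom_pos _)
  have hgap : BMatching.distortionGap (BMatching.RSBS sel) ≤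
      ENNReal.ofReal (BMatching.gapBound (1 / 2)) := iSup_le fun Q =>
    (BMatching.div_bestDistortionOn_le (hwell Q)).trans (ENNReal.ofReal_le_ofReal
      (BMatching.gapBound_le_half (hratio Q).1 (hratio Q).2))
  refine ⟨fun Q => ⟨BMatching.survivalProb_mem,
    fun _ hi => BMatching.burningProb_mem (hsel Q) hi, BMatching.stealingProb_mem⟩, hwell, ?_,
    fun Q => BMatching.div_bestDistortionOn_le (hwell Q),
    fun y hy => BMatching.gapBound_le_half hy.1 hy.2, BMatching.gapBound_half_eq, ?_, ?_⟩
  · refine iSup_le fun Q => (hwell Q).trans (ENNReal.ofReal_le_ofReal ?_)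
    have h1 := BMatching.mul_exp_le_exp_neg_one Q.ratio
    have h2 := BMatching.exp_neg_one_bounds.2
    have h3 : Real.exp 1 / (Real.exp 1 - 1) = (1 - Real.exp (-1))⁻¹ := by
      rw [Real.exp_neg]
      have := Real.exp_pos 1
      field_simp
    rw [h3]
    exact inv_anti₀ (by linarith) (by linarith)
  · rwa [← BMatching.gapBound_half_eq]
  · exact hgap.trans (ENNReal.ofReal_le_ofReal BMatching.gapBound_half_le)
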